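/- **Conventions.** Fix an integer $d\ge 1$; $\|\cdot\|$ is the Frobenius norm and $O(d)\subseteq\mathbb R^{d\times d}$ the orthogonal group. Let $\mathrm{Gr}_{d,n}\subseteq\mathbb R^{n\times n}$ be the set of matrices $A=A^t=A^2$ of rank $d$, and $\mathrm{St}_{d,n}\subseteq\mathbb R^{n\times d}$ the set of matrices with orthonormal columns. For $\varepsilon\in(0,\infty]$ let $\mathrm{Gr}_{d,n}^{\varepsilon}$ be the set of matrices in $\mathbb R^{n\times n}$ at distance $<\varepsilon$ from some element of $\mathrm{Gr}_{d,n}$, and let $\mathrm{Gr}_{d,n}^{0}=\mathrm{Gr}_{d,n}$. Adding zero rows and columns, put $\mathrm{Gr}_d^{\varepsilon}=\bigcup_n\mathrm{Gr}_{d,n}^{\varepsilon}$ and $\mathrm{St}_d=\bigcup_n\mathrm{St}_{d,n}$, with the direct limit topologies. $[B,Y]$ is the set of homotopy classes of continuous maps $B\to Y$; for $a\le b$ the inclusion $\mathrm{Gr}_d^a\subseteq\mathrm{Gr}_d^b$ induces $[B,\mathrm{Gr}_d^a]\to[B,\mathrm{Gr}_d^b]$, and two classes are said to become equal in $[B,\mathrm{Gr}_d^b]$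 if their images under this map agree. Let $\mathcal U=\{U_i\}_{i\in I}$ be an open cover of $B$ and $\varepsilon\in[0,\infty]$. An *$\varepsilon$-approximate cocycle* is a family of continuous maps $\Omega_{ij}:U_i\cap U_j\to O(d)$ with $\Omega_{ij}=\Omega_{ji}^{-1}$ and $\|\Omega_{ij}(y)\Omega_{jk}(y)-\Omega_{ik}(y)\|<\varepsilon$ on $U_i\cap U_j\cap U_k$ (with $\Omega_{ij}\Omega_{jk}=\Omega_{ik}$, if $\varepsilon=0$). The set of these is $Z^1_\varepsilon(\mathcal U)$, and $d_Z(\Omega,\Lambda)=\sup_{i,j}\sup_{y\in U_i\cap U_j}\|\Omega_{ij}(y)-\Lambda_{ij}(y)\|$. Families $\Theta=\{\Theta_i:U_i\to O(d)\}$ of continuous maps act by $(\Theta\cdot\Omega)_{ij}=\Theta_i\Omega_{ij}\Theta_j^{-1}$; the set of orbits is the $\varepsilon$-approximate cohomology set $H^1_\varepsilon(\mathcal U)$, and $d_H$ of two orbits is the infimum of $d_Z$ over representatives in $Z^1_\varepsilon(\mathcal U)$. An *$\varepsilon$-approximate local trivialization* is a family of continuous maps $\Phi_i:U_i\to\mathrm{St}_d$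 such that for all $i,j$ there is a continuous $\Omega_{ij}:U_i\cap U_j\to O(d)$ with $\|\Phi_i(y)\Omega_{ij}(y)-\Phi_j(y)\|<\varepsilon$ on $U_i\cap U_j$ (with $\Phi_i\Omega_{ij}=\Phi_j$, if $\varepsilon=0$). A *refinement* $\nu:\mathcal V\to\mathcal U$, with $\mathcal V=\{V_j\}_{j\in J}$, is a map $\nu:J\to I$ with $V_j\subseteq U_{\nu(j)}$; it induces $\nu:H^1_\varepsilon(\mathcal U)\to H^1_\varepsilon(\mathcal V)$, $\nu(\Omega)_{jk}=\Omega_{\nu(j)\nu(k)}$. Given a locally finite partition of unity $\phi$ subordinate to $\mathcal U$, an injection $\iota:I\to\mathbb N$ and $\Omega\in Z^1_\varepsilon(\mathcal U)$, let $\mathsf{triv}^{\phi,\iota}(\Omega)_i(y)$, for $y\in U_i$, be the matrix with $d$ columns whose rows $d\,\iota(j),\dots,d(\iota(j)+1)-1$ form the block $\sqrt{\phi_j(y)}\,\Omega_{ij}(y)^t$ for each $j\in I$ (zero if $y\notin U_j$), all other rows being zero; here rows are numbered from $0$. For a family $\Phi$ of maps $\Phi_i:U_i\to\mathrm{St}_d$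 let $\mathsf{av}^\phi(\Phi)(y)=\sum_{i}\phi_i(y)\,\Phi_i(y)\Phi_i(y)^t$. **Theorem.** Let $B$ be a paracompact Hausdorff space, $\mathcal U$ a countable open cover of $B$ (that is, $I$ is countable), and $\varepsilon\in[0,\infty]$. 1. For all $\phi$, $\iota$ and $\Omega$ as above, $\Phi=\mathsf{triv}^{\phi,\iota}(\Omega)$ is an $\varepsilon$-approximate local trivialization and $\mathsf{av}^\phi(\Phi)$ is a continuous map $B\to\mathrm{Gr}_d^{\sqrt2\varepsilon}$. There is a unique map $$\mathsf{cl}:H^1_\varepsilon(\mathcal U)\to[B,\mathrm{Gr}_d^{\sqrt2\varepsilon}]$$ such that $\mathsf{cl}([\Omega])=[\mathsf{av}^\phi(\mathsf{triv}^{\phi,\iota}(\Omega))]$ for all $\Omega\in Z^1_\varepsilon(\mathcal U)$, all subordinate partitions of unity $\phi$ and all injections $\iota:I\to\mathbb N$. In particular, this homotopy class does not depend on the choice of $\phi$, of $\iota$, or of the representative $\Omega$. 2. If $\Omega,\Lambda\in H^1_\varepsilon(\mathcal U)$, $\delta\in[0,\infty]$ and $d_H(\Omega,\Lambda)<\delta$,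 then $\mathsf{cl}(\Omega)$ and $\mathsf{cl}(\Lambda)$ become equal in $[B,\mathrm{Gr}_d^{\sqrt2(\varepsilon+\delta)}]$. 3. If $\mathcal V$ is a countable open cover of $B$, $\mu,\nu:\mathcal V\to\mathcal U$ are refinements and $\Omega\in H^1_\varepsilon(\mathcal U)$, then $\mathsf{cl}(\mu(\Omega))$ and $\mathsf{cl}(\nu(\Omega))$, where $\mathsf{cl}$ is the map of part 1 for $\mathcal V$, become equal in $[B,\mathrm{Gr}_d^{2\sqrt2\varepsilon}]$. -/

import Mathlib

open scoped ENNReal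
open TopologicalSpace

namespace ApproxBundle

/-! ### Matrices and the Frobenius norm -/

/-- The Frobenius norm of a real matrix. It is used only for matrices with finitely many non-zero
entries; the index types may be infinite. -/
noncomputable def frob {m n : Type*} (A : Matrix m n ℝ) : ℝ :=
  Real.sqrt (∑ᶠ p : m × n, A p.1 p.2 ^ 2)

/-- The Frobenius distance from `A` to `A'` is less than `ε`, when `ε > 0`;
for `ε = 0` this says `A = A'`. (If `ε > 0`, the first alternative is contained in the second.) -/
def Near {m n : Type*} (ε : ℝ≥0∞) (A A' : Matrix m n ℝ) : Prop :=
  A = A' ∨ ENNReal.ofReal (frob (A - A')) < ε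

theorem Near.mono {m n : Type*} {a b : ℝ≥0∞} (h : a ≤ b) {A A' : Matrix m n ℝ}
    (hA : Near a A A') : Near b A A' :=
  hA.imp id fun h' => h'.trans_le h

/-- The orthogonal group `O(d)`, as a group of matrices with the subspace topology. -/
abbrev OGrp (d : ℕ) := ↥(Matrix.orthogonalGroup (Fin d) ℝ)

/-! ### Increasing unions with the direct limit topology -/

/-- The union in `X` of the images of the sets `S n ⊆ Y n` under the inclusions `e n : Y n → X`. -/
def DirUnion {X : Type*} {Y : ℕ → Type*} (e : ∀ n, Y n → X) (S : ∀ n, Set (Y n)) : Type _ :=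
  {x : X // ∃ n, ∃ a ∈ S n, e n a = x}

/-- The inclusion of the `n`-th stage in the union. -/
def DirUnion.of {X : Type*} {Y : ℕ → Type*} (e : ∀ n, Y n → X) (S : ∀ n, Set (Y n)) (n : ℕ) :
    ↥(S n) → DirUnion e S :=
  fun a => ⟨e n a.1, n, a.1, a.2, rfl⟩

/-- The direct limit topology: the finest one for which all `S n → ⋃ S n` are continuous. -/
instance {X : Type*} {Y : ℕ → Type*} [∀ n, TopologicalSpace (Y n)] (e : ∀ n, Y n → X)
    (S : ∀ n, Set (Y n)) : TopologicalSpace (DirUnion e S) :=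
  ⨆ n, TopologicalSpace.coinduced (DirUnion.of e S n) inferInstance

/-- A stagewise inclusion induces a continuous inclusion of the unions. -/
def DirUnion.incl {X : Type*} {Y : ℕ → Type*} [∀ n, TopologicalSpace (Y n)] (e : ∀ n, Y n → X)
    {S T : ∀ n, Set (Y n)} (h : ∀ n, S n ⊆ T n) : C(DirUnion e S, DirUnion e T) where
  toFun x := ⟨x.1, x.2.imp fun n ⟨a, ha, hx⟩ => ⟨a, h n ha, hx⟩⟩
  continuous_toFun := by
    refine continuous_iSup_dom.2 fun n => continuous_coinduced_dom.2 ?_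
    have h1 : Continuous (DirUnion.of e T n) :=
      continuous_iSup_rng (i := n) continuous_coinduced_rng
    exact h1.comp (continuous_inclusion (h n))

/-! ### Stiefel manifolds, Grassmannians and their thickenings -/

/-- `ℝ^{n × n} → ℝ^{∞ × ∞}`, adding zero rows and columns. -/
def padSq (n : ℕ) (A : Matrix (Fin n) (Fin n) ℝ) : Matrix ℕ ℕ ℝ :=
  fun a b => if h : a < n ∧ b < n then A ⟨a, h.1⟩ ⟨b, h.2⟩ else 0

/-- `ℝ^{n × d} → ℝ^{∞ × d}`, adding zero rows. -/
def padRows (d n : ℕ) (M : Matrix (Fin n) (Fin d) ℝ) : Matrix ℕ (Fin d) ℝ :=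
  fun a c => if h : a < n then M ⟨a, h⟩ c else 0

/-- `St_{d,n}`: the `n × d` matrices with orthonormal columns. -/
def stiefelFin (d n : ℕ) : Set (Matrix (Fin n) (Fin d) ℝ) :=
  {M | M.transpose * M = 1}

/-- `Gr_{d,n}`: the symmetric idempotent `n × n` matrices of rank `d`. -/
def grassFin (d n : ℕ) : Set (Matrix (Fin n) (Fin n) ℝ) :=
  {A | A.transpose = A ∧ A * A = A ∧ A.rank = d}

/-- `Gr_{d,n}^ε`: the matrices at Frobenius distance less than `ε` from `Gr_{d,n}`
(`Gr_{d,n}` itself if `ε = 0`). -/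
def thickGrassFin (d : ℕ) (ε : ℝ≥0∞) (n : ℕ) : Set (Matrix (Fin n) (Fin n) ℝ) :=
  {A | ∃ P ∈ grassFin d n, Near ε A P}

/-- The infinite Stiefel manifold `St_d = ⋃ St_{d,n}`, with the direct limit topology. -/
abbrev Stiefel (d : ℕ) := DirUnion (padRows d) (stiefelFin d)

/-- The thickened infinite Grassmannian `Gr_d^ε = ⋃ Gr_{d,n}^ε`, with the direct limit topology.
Since `A ∈ ℝ^{∞ × ∞}` and `P ∈ Gr_d` always lie in a common `ℝ^{n × n}`, these are the finitely
supported matrices at Frobenius distance less than `ε` from `Gr_d`. For `ε = 0` this is `Gr_d`. -/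
abbrev ThickGrass (d : ℕ) (ε : ℝ≥0∞) := DirUnion padSq (thickGrassFin d ε)

/-- The inclusion `Gr_d^a ⊆ Gr_d^b` for `a ≤ b`. -/
def thickIncl (d : ℕ) {a b : ℝ≥0∞} (h : a ≤ b) : C(ThickGrass d a, ThickGrass d b) :=
  DirUnion.incl padSq fun _ _ ⟨P, hP, hA⟩ => ⟨P, hP, hA.mono h⟩

/-! ### Homotopy classes of maps -/

/-- `[X, Y]`: continuous maps up to homotopy. -/
abbrev HomotopyClasses (X Y : Type*) [TopologicalSpace X] [TopologicalSpace Y] :=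
  Quotient (⟨ContinuousMap.Homotopic, ContinuousMap.Homotopic.equivalence⟩ : Setoid C(X, Y))

/-- The map `[X, Gr_d^a] → [X, Gr_d^b]` induced by inclusion, for `a ≤ b`. -/
def widen {X : Type*} [TopologicalSpace X] (d : ℕ) {a b : ℝ≥0∞} (h : a ≤ b) :
    HomotopyClasses X (ThickGrass d a) → HomotopyClasses X (ThickGrass d b) :=
  Quotient.map (fun f => (thickIncl d h).comp f)
    fun _ _ hfg => (ContinuousMap.Homotopic.refl (thickIncl d h)).comp hfg

/-- The constant `√2`. -/
noncomputable def sqrtTwo : ℝ≥0∞ := ENNReal.ofReal (Real.sqrt 2)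

theorem sqrtTwo_mul_le_add (ε δ : ℝ≥0∞) : sqrtTwo * ε ≤ sqrtTwo * (ε + δ) :=
  mul_le_mul' le_rfl le_self_add

theorem sqrtTwo_mul_le_two (ε : ℝ≥0∞) : sqrtTwo * ε ≤ 2 * sqrtTwo * ε :=
  mul_le_mul' (le_mul_of_one_le_left' one_le_two) le_rfl

/-! ### Approximate cocycles and approximate cohomology -/

section Cech

variable {B : Type*} [TopologicalSpace B] {I : Type*}

/-- `O(d)`-valued `1`-cochains: symmetric families of continuous maps `U_i ∩ U_j → O(d)`.
(If `U_i ∩ U_j = ∅` there is exactly one such map, so these indices carry no data.) -/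
structure Cochain (U : I → Opens B) (d : ℕ) where
  val : ∀ i j : I, C(↥(U i ⊓ U j), OGrp d)
  symm : ∀ (i j : I) (y : B) (hi : y ∈ U i) (hj : y ∈ U j),
    val i j ⟨y, hi, hj⟩ = (val j i ⟨y, hj, hi⟩)⁻¹

/-- `Z^1_ε(U; O(d))`: the `ε`-approximate cocycles (the exact ones for `ε = 0`). -/
structure ApproxCocycle (U : I → Opens B) (d : ℕ) (ε : ℝ≥0∞) extends Cochain U d where
  near : ∀ (i j k : I) (y : B) (hi : y ∈ U i) (hj : y ∈ U j) (hk : y ∈ U k),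
    Near ε ((val i j ⟨y, hi, hj⟩ * val j k ⟨y, hj, hk⟩ : OGrp d) : Matrix (Fin d) (Fin d) ℝ)
      (val i k ⟨y, hi, hk⟩ : Matrix (Fin d) (Fin d) ℝ)

/-- `d_Z(Ω, Λ) = sup_{i,j} sup_{y ∈ U_i ∩ U_j} ‖Ω_ij(y) - Λ_ij(y)‖`. -/
noncomputable def distZ {U : I → Opens B} {d : ℕ} {ε : ℝ≥0∞} (Ω Λ : ApproxCocycle U d ε) : ℝ≥0∞ :=
  ⨆ (i : I) (j : I) (y : ↥(U i ⊓ U j)), ENNReal.ofReal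
    (frob ((Ω.val i j y : Matrix (Fin d) (Fin d) ℝ) - (Λ.val i j y : Matrix (Fin d) (Fin d) ℝ)))

/-- The orbit relation of the action of the `0`-cochains `Θ = {Θ_i : U_i → O(d)}` on approximate
cocycles by `(Θ · Ω)_ij = Θ_i Ω_ij Θ_j⁻¹`. -/
def cohomologous (U : I → Opens B) (d : ℕ) (ε : ℝ≥0∞) : Setoid (ApproxCocycle U d ε) where
  r Ω Λ := ∃ Θ : ∀ i : I, C(↥(U i), OGrp d),
    ∀ (i j : I) (y : B) (hi : y ∈ U i) (hj : y ∈ U j),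
      Λ.val i j ⟨y, hi, hj⟩ = Θ i ⟨y, hi⟩ * Ω.val i j ⟨y, hi, hj⟩ * (Θ j ⟨y, hj⟩)⁻¹
  iseqv :=
    { refl := fun Ω => ⟨fun _ => ContinuousMap.const _ 1, fun i j y hi hj => by simp⟩
      symm := by
        rintro Ω Λ ⟨Θ, h⟩
        refine ⟨fun i => (Θ i)⁻¹, fun i j y hi hj => ?_⟩
        rw [h i j y hi hj]
        simp only [ContinuousMap.inv_apply]
        group
      trans := by
        rintro Ω Λ Ξ ⟨Θ, h⟩ ⟨Θ', h'⟩
        refine ⟨fun i => Θ' i * Θ i, fun i j y hi hj => ?_⟩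
        rw [h' i j y hi hj, h i j y hi hj]
        simp only [ContinuousMap.mul_apply]
        group }

/-- The `ε`-approximate cohomology set `H^1_ε(U; O(d))`. -/
abbrev ApproxCohomology (U : I → Opens B) (d : ℕ) (ε : ℝ≥0∞) :=
  Quotient (cohomologous U d ε)

/-- The class `[Ω]` of an approximate cocycle. -/
def ApproxCocycle.cls {U : I → Opens B} {d : ℕ} {ε : ℝ≥0∞} (Ω : ApproxCocycle U d ε) :
    ApproxCohomology U d ε :=
  Quotient.mk _ Ω

/-- The distance `d_H` on approximate cohomology: the infimum of `d_Z` over representatives. -/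
noncomputable def distH {U : I → Opens B} {d : ℕ} {ε : ℝ≥0∞} (x x' : ApproxCohomology U d ε) :
    ℝ≥0∞ :=
  ⨅ (Ω : ApproxCocycle U d ε) (Λ : ApproxCocycle U d ε) (_ : Ω.cls = x) (_ : Λ.cls = x'),
    distZ Ω Λ

/-! ### Refinements -/

/-- A refinement `V → U` of covers. -/
structure Refinement {J : Type*} (V : J → Opens B) (U : I → Opens B) where
  idx : J → I
  le : ∀ j, V j ≤ U (idx j)

/-- The pullback `ν(Ω)_jk = Ω_{ν(j)ν(k)}`, restricted to `V_j ∩ V_k`. -/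
def Refinement.pullback {J : Type*} {V : J → Opens B} {U : I → Opens B} (ν : Refinement V U)
    {d : ℕ} {ε : ℝ≥0∞} (Ω : ApproxCocycle U d ε) : ApproxCocycle V d ε where
  val j k := (Ω.val (ν.idx j) (ν.idx k)).comp
    ⟨Set.inclusion fun _ hy => ⟨ν.le j hy.1, ν.le k hy.2⟩, continuous_inclusion _⟩
  symm j k y hj hk := Ω.symm _ _ y (ν.le j hj) (ν.le k hk)
  near i j k y hi hj hk := Ω.near _ _ _ y (ν.le i hi) (ν.le j hj) (ν.le k hk)

/-- The map `H^1_ε(U; O(d)) → H^1_ε(V; O(d))` induced by a refinement `V → U`. -/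
def Refinement.map {J : Type*} {V : J → Opens B} {U : I → Opens B} (ν : Refinement V U)
    (d : ℕ) (ε : ℝ≥0∞) : ApproxCohomology U d ε → ApproxCohomology V d ε :=
  Quotient.map ν.pullback fun _ _ ⟨Θ, h⟩ =>
    ⟨fun j => (Θ (ν.idx j)).comp ⟨Set.inclusion (ν.le j), continuous_inclusion _⟩,
      fun j k y hj hk => h _ _ y (ν.le j hj) (ν.le k hk)⟩

/-! ### Approximate local trivializations and the classifying map -/

/-- `ε`-approximate local trivializations: families of continuous maps `Φ_i : U_i → St_d` such that
for all `i, j` there is a continuous `Ω_ij : U_i ∩ U_j → O(d)` with `‖Φ_i Ω_ij - Φ_j‖ < ε`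
pointwise (with `Φ_i Ω_ij = Φ_j`, if `ε = 0`). -/
structure ApproxLocalTriv (U : I → Opens B) (d : ℕ) (ε : ℝ≥0∞) where
  val : ∀ i : I, C(↥(U i), Stiefel d)
  witness : ∀ i j : I, ∃ Ω : C(↥(U i ⊓ U j), OGrp d),
    ∀ (y : B) (hi : y ∈ U i) (hj : y ∈ U j),
      Near ε ((val i ⟨y, hi⟩).1 * (Ω ⟨y, hi, hj⟩ : Matrix (Fin d) (Fin d) ℝ)) (val j ⟨y, hj⟩).1

open Classical in
/-- The value at `y ∈ U_i` of the local trivialization built from a cochain `Ω`, a partition of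
unity `φ` and an enumeration `ι` of the cover: for each `j`, the rows `d * ι j, …, d * (ι j + 1) - 1`
form the block `√(φ_j(y)) Ω_ij(y)ᵗ` (zero if `y ∉ U_j`), and all other rows vanish. -/
noncomputable def trivMatrix {U : I → Opens B} {d : ℕ} [NeZero d] (φ : PartitionOfUnity I B)
    (ι : I ↪ ℕ) (Ω : Cochain U d) (i : I) (y : ↥(U i)) : Matrix ℕ (Fin d) ℝ :=
  fun m c => ∑ᶠ j : I, if h : ι j = m / d ∧ (y : B) ∈ U j then
    Real.sqrt (φ j y) *
      (Ω.val i j ⟨y, y.2, h.2⟩ : Matrix (Fin d) (Fin d) ℝ).transpose (Fin.ofNat d m) c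
  else 0

open Classical in
/-- `∑_i φ_i(y) P(Φ_i(y))`, where `P(M) = M Mᵗ` is the projection on the span of the frame `M`;
the sum is over the `i` with `y ∈ U_i`. -/
noncomputable def avMatrix {U : I → Opens B} {d : ℕ} {ε : ℝ≥0∞} (φ : PartitionOfUnity I B)
    (Φ : ApproxLocalTriv U d ε) (y : B) : Matrix ℕ ℕ ℝ :=
  ∑ᶠ i : I, if h : y ∈ U i then
    φ i y • ((Φ.val i ⟨y, h⟩).1 * (Φ.val i ⟨y, h⟩).1.transpose)
  else 0

/-- `cl` is the map induced on approximate cohomology by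
approximate cocycle ↦ approximate local trivialization ↦ averaged classifying map ↦ homotopy class.
That is, for **every** partition of unity `φ` subordinate to `U`, **every** enumeration `ι` and
**every** `Ω ∈ Z^1_ε(U; O(d))`: the matrices `trivMatrix φ ι Ω` form an `ε`-approximate local
trivialization `Φ`, the averages `avMatrix φ Φ` form a continuous map `f : B → Gr_d^{√2 ε}`, and
`cl` maps `[Ω]` to the homotopy class of `f`. -/
def IsClassifying {U : I → Opens B} {d : ℕ} [NeZero d] {ε : ℝ≥0∞}
    (cl : ApproxCohomology U d ε → HomotopyClasses B (ThickGrass d (sqrtTwo * ε))) : Prop :=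
  ∀ φ : PartitionOfUnity I B, φ.IsSubordinate (fun i => (U i : Set B)) →
    ∀ (ι : I ↪ ℕ) (Ω : ApproxCocycle U d ε),
      ∃ Φ : ApproxLocalTriv U d ε,
        (∀ (i : I) (y : ↥(U i)), (Φ.val i y).1 = trivMatrix φ ι Ω.toCochain i y) ∧
        ∃ f : C(B, ThickGrass d (sqrtTwo * ε)),
          (∀ y : B, (f y).1 = avMatrix φ Φ y) ∧ cl Ω.cls = Quotient.mk _ f

end Cech

end ApproxBundle

open ApproxBundle

open scoped Topology

namespace ApproxBundle

/-! Since `Ω_ijᵗ = Ω_ji`, the frame `Φ_i` consists of the blocks `√φ_k Ω_ki`, in rows determined by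
the enumeration. The Gram matrix of two frames with the same weights is the weighted average of the
products of their blocks (`truncRows_transpose_mul`). Hence `Φ_i` is orthonormal, and `‖Φ_i Ω_ij -
Φ_j‖²` is an average of the numbers `‖Ω_ki Ω_ij - Ω_kj‖²`. Passing from frames to projections costs
a factor `√2` (`frob_mul_transpose_sub_le`), so the average of the projections is within `√2 ε` of
each projection that occurs in it. Local finiteness confines the construction, near each point, to
one finite stage; this gives continuity for the direct limit topology
(`exists_continuousMap_avgMat`).

All homotopies are instances of the same construction over `[0, 1] × B`. The cover is doubled, a
cocycle `Ξ` on the doubled cover restricts to `Ω` and `Λ` on the two copies, and a partition of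
unity moves its weight from the first copy to the second (`homotopic_of_interpolate`). The
enumeration of the doubled index set need only be injective on the weights that are non-zero at the
same point. Thus the blocks of any enumeration can be moved to odd positions one after the other,
and from there to the even positions of any other enumeration (`homotopic_of_isAverage`).

It remains to find `Ξ`. For cohomologous cocycles it is a gauge transform of the pullback of `Ω` to
the doubled cover; for cocycles at distance less than `δ` it is an `(ε + δ)`-cocycle glued from
both; for refinements `μ`, `ν` it is the pullback along both at once. The last is still an
`ε`-cocycle, so part 3 holds before widening. -/

theorem finsum_eq_finsum_comp {α β M : Type*} [AddCommMonoid M] {f : β → M} {e : α → β}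
    (he : Function.Injective e) (h : ∀ b, b ∉ Set.range e → f b = 0) :
    ∑ᶠ b, f b = ∑ᶠ a, f (e a) := by
  rw [← finsum_mem_univ, finsum_mem_inter_support_eq' _ _ (Set.range e), finsum_mem_range he]
  exact fun b hb => ⟨fun _ => by_contra fun hb' => hb (h b hb'), fun _ => trivial⟩

/-! ### Frobenius norm estimates -/

section Frobenius

variable {m n p q : Type*} [Fintype m] [Fintype n] [Fintype p] [Fintype q]

theorem frob_nonneg {m n : Type*} (A : Matrix m n ℝ) : 0 ≤ frob A := Real.sqrt_nonneg _

theorem frob_eq_norm (A : Matrix m n ℝ) :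
    frob A = ‖WithLp.toLp 2 (fun p : m × n => A p.1 p.2)‖ := by
  rw [EuclideanSpace.norm_eq]
  simp [frob, finsum_eq_sum_of_fintype]

theorem frob_sub_comm {m n : Type*} (A B : Matrix m n ℝ) : frob (A - B) = frob (B - A) := by
  unfold frob
  congr 1
  refine finsum_congr fun x => ?_
  simp only [Matrix.sub_apply]
  ring

theorem frob_sq_eq_trace (A : Matrix m n ℝ) : frob A ^ 2 = (A.transpose * A).trace := by
  rw [frob, Real.sq_sqrt (finsum_nonneg fun _ => sq_nonneg _), finsum_eq_sum_of_fintype,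
    Fintype.sum_prod_type, Finset.sum_comm]
  simp [Matrix.trace, Matrix.mul_apply, sq]

theorem eq_of_frob_sub_nonpos {A B : Matrix m n ℝ} (h : frob (A - B) ≤ 0) : A = B := by
  have h0 : frob (A - B) = 0 := le_antisymm h (frob_nonneg _)
  rw [frob_eq_norm, norm_eq_zero] at h0
  ext i j
  have := congrArg (fun v : EuclideanSpace ℝ (m × n) => v (i, j)) h0
  simpa [sub_eq_zero] using this

theorem frob_add_le (A B : Matrix m n ℝ) : frob (A + B) ≤ frob A + frob B := by
  have h : (WithLp.toLp 2 fun p : m × n => (A + B) p.1 p.2) =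
      (WithLp.toLp 2 fun p : m × n => A p.1 p.2) + WithLp.toLp 2 fun p : m × n => B p.1 p.2 := rfl
  rw [frob_eq_norm, frob_eq_norm, frob_eq_norm, h]
  exact norm_add_le _ _

theorem frob_sum_smul_le {K : Type*} (F : Finset K) (w : K → ℝ) (hw : ∀ k ∈ F, 0 ≤ w k)
    (A : K → Matrix m n ℝ) : frob (∑ k ∈ F, w k • A k) ≤ ∑ k ∈ F, w k * frob (A k) := by
  classical
  induction F using Finset.induction_on with
  | empty => simp [frob]
  | insert a s ha ih =>
    rw [Finset.sum_insert ha, Finset.sum_insert ha]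
    refine (frob_add_le _ _).trans (add_le_add (le_of_eq ?_)
      (ih fun k hk => hw k (Finset.mem_insert_of_mem hk)))
    rw [frob_eq_norm, frob_eq_norm]
    have : (WithLp.toLp 2 fun p : m × n => (w a • A a) p.1 p.2) =
        w a • (WithLp.toLp 2 fun p : m × n => A a p.1 p.2) := rfl
    rw [this, norm_smul, Real.norm_of_nonneg (hw a (Finset.mem_insert_self _ _))]

theorem frob_mul_orthogonal [DecidableEq m] [DecidableEq n] (P : Matrix.orthogonalGroup m ℝ)
    (A : Matrix m n ℝ) (Q : Matrix.orthogonalGroup n ℝ) :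
    frob ((P : Matrix m m ℝ) * A * (Q : Matrix n n ℝ)) = frob A := by
  have hP : (P : Matrix m m ℝ).transpose * (P : Matrix m m ℝ) = 1 :=
    (Matrix.mem_orthogonalGroup_iff' m ℝ).1 P.2
  have hQ : (Q : Matrix n n ℝ) * (Q : Matrix n n ℝ).transpose = 1 :=
    (Matrix.mem_orthogonalGroup_iff n ℝ).1 Q.2
  rw [← sq_eq_sq₀ (frob_nonneg _) (frob_nonneg _), frob_sq_eq_trace, frob_sq_eq_trace]
  calc _ = ((Q : Matrix n n ℝ).transpose * (A.transpose *
        ((P : Matrix m m ℝ).transpose * (P : Matrix m m ℝ)) * A * (Q : Matrix n n ℝ))).trace := by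
        simp only [Matrix.transpose_mul, Matrix.mul_assoc]
    _ = _ := by
        rw [hP, Matrix.trace_mul_comm, Matrix.mul_one, Matrix.mul_assoc, hQ, Matrix.mul_one]

theorem Near.symm {m n : Type*} {ε : ℝ≥0∞} {A B : Matrix m n ℝ} (h : Near ε A B) : Near ε B A :=
  h.imp Eq.symm fun h => by rwa [frob_sub_comm]

theorem Near.trans {ε δ : ℝ≥0∞} {A B C : Matrix m n ℝ} (h : Near ε A B) (h' : Near δ B C) :
    Near (ε + δ) A C := by
  rcases h with rfl | h
  · exact h'.mono le_add_self
  rcases h' with rfl | h'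
  · exact Or.inr (h.trans_le le_self_add)
  refine Or.inr (lt_of_le_of_lt ?_ (ENNReal.add_lt_add h h'))
  rw [← ENNReal.ofReal_add (frob_nonneg _) (frob_nonneg _)]
  refine ENNReal.ofReal_le_ofReal ?_
  simpa using frob_add_le (A - B) (B - C)

/-- Treats exact and approximate bounds together: equality of `A` and `B` forces `frob (C - D) ≤ 0`,
which means `C = D` because `C` and `D` are finite; otherwise `c > 0` keeps the inequality strict.
-/
theorem Near.of_frob_le {m n p q : Type*} [Fintype p] [Fintype q] {ε : ℝ≥0∞} {A B : Matrix m n ℝ} {C D : Matrix p q ℝ} {c : ℝ} (hc : 0 < c)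
    (h : Near ε A B) (hle : frob (C - D) ≤ c * frob (A - B)) :
    Near (ENNReal.ofReal c * ε) C D := by
  rcases h with rfl | h
  · left
    refine eq_of_frob_sub_nonpos (hle.trans ?_)
    simp [frob]
  · right
    refine (ENNReal.ofReal_le_ofReal hle).trans_lt ?_
    rw [ENNReal.ofReal_mul hc.le]
    exact ENNReal.mul_lt_mul_right (by simpa using hc) ENNReal.ofReal_ne_top h

theorem Near.mul_orthogonal [DecidableEq m] [DecidableEq n] {ε : ℝ≥0∞} {A B : Matrix m n ℝ}
    (h : Near ε A B) (P : Matrix.orthogonalGroup m ℝ) (Q : Matrix.orthogonalGroup n ℝ) :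
    Near ε ((P : Matrix m m ℝ) * A * (Q : Matrix n n ℝ))
      ((P : Matrix m m ℝ) * B * (Q : Matrix n n ℝ)) := by
  rcases h with rfl | h
  · exact Or.inl rfl
  · right
    rwa [← Matrix.sub_mul, ← Matrix.mul_sub, frob_mul_orthogonal]

/-- An average does not exceed its largest term. Selecting one such term carries the relation `Near
ε` from single blocks to averages, for every `ε` including `0` and `∞`. -/
theorem exists_le_of_le_sum_mul {K : Type*} {F : Finset K} {w a : K → ℝ} {b : ℝ}
    (hw : ∀ k ∈ F, 0 < w k) (h1 : ∑ k ∈ F, w k = 1) (h : b ≤ ∑ k ∈ F, w k * a k) :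
    ∃ k ∈ F, b ≤ a k := by
  by_contra! hc
  have hne : F.Nonempty := by
    rw [Finset.nonempty_iff_ne_empty]
    rintro rfl
    simp at h1
  have := Finset.sum_lt_sum_of_nonempty hne fun k hk => mul_lt_mul_of_pos_left (hc k hk) (hw k hk)
  rw [← Finset.sum_mul, h1, one_mul] at this
  exact this.not_ge h

theorem frob_padRows_sub {d n : ℕ} (A B : Matrix (Fin n) (Fin d) ℝ) :
    frob (padRows d n A - padRows d n B) = frob (A - B) := by
  unfold frob
  congr 1
  have hinj : Function.Injective (Prod.map Fin.val id : Fin n × Fin d → ℕ × Fin d) :=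
    Fin.val_injective.prodMap Function.injective_id
  rw [finsum_eq_finsum_comp hinj]
  · refine finsum_congr fun x => ?_
    simp [padRows]
  · rintro ⟨a, c⟩ h
    have ha : ¬ a < n := fun ha => h ⟨(⟨a, ha⟩, c), rfl⟩
    simp [padRows, ha]

theorem Near.padRows {d n : ℕ} {ε : ℝ≥0∞} {A B : Matrix (Fin n) (Fin d) ℝ} (h : Near ε A B) :
    Near ε (padRows d n A) (padRows d n B) :=
  h.imp (fun h => by rw [h]) fun h => by rwa [frob_padRows_sub]

theorem mul_transpose_mem_grassFin {d n : ℕ} {M : Matrix (Fin n) (Fin d) ℝ}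
    (hM : M ∈ stiefelFin d n) : M * M.transpose ∈ grassFin d n := by
  have hM' : M.transpose * M = 1 := hM
  refine ⟨by simp, ?_, ?_⟩
  · rw [Matrix.mul_assoc, ← Matrix.mul_assoc M.transpose, hM', Matrix.one_mul]
  · rw [Matrix.rank_self_mul_transpose, ← Matrix.rank_transpose_mul_self, hM', Matrix.rank_one,
      Fintype.card_fin]

/-- The distance between the projections onto the spans of two frames is at most `√2` times the
distance between the frames, up to a change of basis in one of them. -/
theorem frob_mul_transpose_sub_le [DecidableEq n] {M M' : Matrix m n ℝ}
    (hM : M.transpose * M = 1) (hM' : M'.transpose * M' = 1) (T : Matrix.orthogonalGroup n ℝ) :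
    frob (M * M.transpose - M' * M'.transpose) ≤
      Real.sqrt 2 * frob (M * (T : Matrix n n ℝ) - M') := by
  have hT : (T : Matrix n n ℝ).transpose * (T : Matrix n n ℝ) = 1 :=
    (Matrix.mem_orthogonalGroup_iff' n ℝ).1 T.2
  have hT' : (T : Matrix n n ℝ) * (T : Matrix n n ℝ).transpose = 1 :=
    (Matrix.mem_orthogonalGroup_iff n ℝ).1 T.2
  obtain ⟨P, hPdef⟩ : ∃ P, P = M * (T : Matrix n n ℝ) := ⟨_, rfl⟩
  have hP : P.transpose * P = 1 := by
    rw [hPdef, Matrix.transpose_mul, Matrix.mul_assoc, ← Matrix.mul_assoc M.transpose, hM,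
      Matrix.one_mul, hT]
  have hPP : M * M.transpose = P * P.transpose := by
    rw [hPdef, Matrix.transpose_mul, Matrix.mul_assoc, ← Matrix.mul_assoc (T : Matrix n n ℝ), hT',
      Matrix.one_mul]
  rw [hPP, ← hPdef]
  -- With `e1`, `e2`, `e3`, the difference `2 ‖P - M'‖² - ‖P Pᵗ - M' M'ᵗ‖²` equals `2 ‖Pᵗ M' - 1‖²`,
  -- hence is non-negative.
  have e1 : frob (P * P.transpose - M' * M'.transpose) ^ 2 =
      2 * (1 : Matrix n n ℝ).trace - 2 * frob (P.transpose * M') ^ 2 := by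
    have a1 : (P * P.transpose * (P * P.transpose)).trace = (1 : Matrix n n ℝ).trace := by
      rw [Matrix.mul_assoc, ← Matrix.mul_assoc P.transpose, hP, Matrix.one_mul,
        Matrix.trace_mul_comm, hP]
    have a2 : (M' * M'.transpose * (M' * M'.transpose)).trace = (1 : Matrix n n ℝ).trace := by
      rw [Matrix.mul_assoc, ← Matrix.mul_assoc M'.transpose, hM', Matrix.one_mul,
        Matrix.trace_mul_comm, hM']
    have a3 : (M' * M'.transpose * (P * P.transpose)).trace = frob (P.transpose * M') ^ 2 := by
      rw [frob_sq_eq_trace, Matrix.transpose_mul, Matrix.transpose_transpose, Matrix.mul_assoc,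
        Matrix.trace_mul_comm]
      simp only [Matrix.mul_assoc]
    have a4 : (P * P.transpose * (M' * M'.transpose)).trace = frob (P.transpose * M') ^ 2 := by
      rw [Matrix.trace_mul_comm, a3]
    rw [frob_sq_eq_trace]
    simp only [Matrix.transpose_sub, Matrix.transpose_mul, Matrix.transpose_transpose,
      Matrix.sub_mul, Matrix.mul_sub, Matrix.trace_sub, a1, a2, a3, a4]
    ring
  have e2 : frob (P - M') ^ 2 = 2 * (1 : Matrix n n ℝ).trace - 2 * (P.transpose * M').trace := by
    have a1 : (M'.transpose * P).trace = (P.transpose * M').trace := by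
      rw [← Matrix.trace_transpose, Matrix.transpose_mul, Matrix.transpose_transpose]
    rw [frob_sq_eq_trace]
    simp only [Matrix.transpose_sub, Matrix.sub_mul, Matrix.mul_sub, Matrix.trace_sub, hP, hM', a1]
    ring
  have e3 : frob (P.transpose * M' - 1) ^ 2 =
      frob (P.transpose * M') ^ 2 - 2 * (P.transpose * M').trace + (1 : Matrix n n ℝ).trace := by
    rw [frob_sq_eq_trace, frob_sq_eq_trace]
    simp only [Matrix.transpose_sub, Matrix.sub_mul, Matrix.mul_sub, Matrix.trace_sub,
      Matrix.transpose_one, Matrix.one_mul, Matrix.mul_one, Matrix.trace_transpose]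
    ring
  refine le_of_pow_le_pow_left₀ two_ne_zero (mul_nonneg (Real.sqrt_nonneg _) (frob_nonneg _)) ?_
  rw [mul_pow, Real.sq_sqrt zero_le_two]
  nlinarith [sq_nonneg (frob (P.transpose * M' - 1))]

end Frobenius

/-! ### Frames assembled from weighted blocks, and averages of their projections -/

section Frames

/-- The first `n` rows of a matrix. -/
def truncRows {d : ℕ} (n : ℕ) (M : Matrix ℕ (Fin d) ℝ) : Matrix (Fin n) (Fin d) ℝ :=
  fun a c => M a c

/-- The upper left `n × n` block of a matrix. -/
def truncSq (n : ℕ) (A : Matrix ℕ ℕ ℝ) : Matrix (Fin n) (Fin n) ℝ :=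
  fun a b => A a b

variable {K : Type*} {d : ℕ} [NeZero d]

/-- The matrix with the block `√(v k) g k` in the rows `d * κ k, …, d * (κ k + 1) - 1`. -/
noncomputable def frameMat (v : K → ℝ) (κ : K → ℕ) (g : K → Matrix (Fin d) (Fin d) ℝ) :
    Matrix ℕ (Fin d) ℝ :=
  fun m c => ∑ᶠ k, if κ k = m / d then Real.sqrt (v k) * g k (Fin.ofNat d m) c else 0

/-- The average with weights `v` of the projections on the spans of the frames with blocks
`√(v k) g k i`. -/
noncomputable def avgMat (v : K → ℝ) (κ : K → ℕ) (g : K → K → Matrix (Fin d) (Fin d) ℝ) :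
    Matrix ℕ ℕ ℝ :=
  ∑ᶠ i, v i • (frameMat v κ (fun k => g k i) * (frameMat v κ fun k => g k i).transpose)

variable {v : K → ℝ} {κ : K → ℕ} {F : Finset K} {N : ℕ}

theorem frameMat_apply_eq_sum (hF : ∀ k, v k ≠ 0 → k ∈ F) (g : K → Matrix (Fin d) (Fin d) ℝ)
    (m : ℕ) (c : Fin d) : frameMat v κ g m c =
      ∑ k ∈ F, if κ k = m / d then Real.sqrt (v k) * g k (Fin.ofNat d m) c else 0 := by
  refine finsum_eq_sum_of_support_subset _ fun k hk => hF k fun h0 => hk ?_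
  simp [h0]

theorem frameMat_mul_sub (hF : ∀ k, v k ≠ 0 → k ∈ F) (g g' : K → Matrix (Fin d) (Fin d) ℝ)
    (T : Matrix (Fin d) (Fin d) ℝ) :
    frameMat v κ g * T - frameMat v κ g' = frameMat v κ fun k => g k * T - g' k := by
  ext m c
  rw [Matrix.sub_apply, Matrix.mul_apply, frameMat_apply_eq_sum hF, frameMat_apply_eq_sum hF]
  simp only [frameMat_apply_eq_sum hF, Finset.sum_mul]
  rw [Finset.sum_comm, ← Finset.sum_sub_distrib]
  refine Finset.sum_congr rfl fun k _ => ?_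
  split_ifs
  · simp only [Matrix.sub_apply, Matrix.mul_apply, mul_sub, Finset.mul_sum, mul_assoc]
  · simp

theorem frameMat_apply_eq_zero (hN : ∀ k, v k ≠ 0 → κ k < N) (g : K → Matrix (Fin d) (Fin d) ℝ)
    {m : ℕ} (hm : N * d ≤ m) (c : Fin d) : frameMat v κ g m c = 0 := by
  refine (finsum_congr fun k => ?_).trans (finsum_zero (α := K))
  split_ifs with h
  · by_cases hk : v k = 0
    · simp [hk]
    · have h1 := hN k hk
      have h2 : N ≤ m / d := (Nat.le_div_iff_mul_le (NeZero.pos d)).2 hm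
      omega
  · rfl

theorem padRows_truncRows_frameMat (hN : ∀ k, v k ≠ 0 → κ k < N)
    (g : K → Matrix (Fin d) (Fin d) ℝ) :
    padRows d (N * d) (truncRows (N * d) (frameMat v κ g)) = frameMat v κ g := by
  ext m c
  unfold padRows truncRows
  split_ifs with h
  · rfl
  · exact (frameMat_apply_eq_zero hN g (not_lt.1 h) c).symm

/-- The Gram matrix of two frames with the same weights. -/
theorem truncRows_transpose_mul (hv : ∀ k, 0 ≤ v k) (hF : ∀ k, v k ≠ 0 ↔ k ∈ F)
    (hκ : Set.InjOn κ {k | v k ≠ 0}) (hN : ∀ k, v k ≠ 0 → κ k < N)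
    (g g' : K → Matrix (Fin d) (Fin d) ℝ) :
    (truncRows (N * d) (frameMat v κ g)).transpose * truncRows (N * d) (frameMat v κ g') =
      ∑ k ∈ F, v k • ((g k).transpose * g' k) := by
  have hF' : ∀ k, v k ≠ 0 → k ∈ F := fun k => (hF k).1
  ext c c'
  rw [Matrix.mul_apply, ← finProdFinEquiv.sum_comp, Fintype.sum_prod_type, Finset.sum_comm]
  have key : ∀ (a : Fin N) (r : Fin d),
      (truncRows (N * d) (frameMat v κ g)).transpose c (finProdFinEquiv (a, r)) *
        truncRows (N * d) (frameMat v κ g') (finProdFinEquiv (a, r)) c' =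
      ∑ k ∈ F, if κ k = a then v k * (g k r c * g' k r c') else 0 := by
    intro a r
    have h1 : (r + d * a : ℕ) / d = a := by
      rw [Nat.add_mul_div_left _ _ (NeZero.pos d), Nat.div_eq_of_lt r.2, zero_add]
    have h2 : Fin.ofNat d (r + d * a : ℕ) = r := by
      ext
      simp [Nat.mod_eq_of_lt r.2]
    simp only [Matrix.transpose_apply, truncRows, finProdFinEquiv_apply_val,
      frameMat_apply_eq_sum hF', h1, h2]
    rw [Finset.sum_mul_sum]
    refine Finset.sum_congr rfl fun k hk => ?_
    -- Cross terms vanish: distinct indices of non-zero weight occupy disjoint blocks of rows.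
    rw [Finset.sum_eq_single k]
    · split_ifs
      · rw [mul_mul_mul_comm, Real.mul_self_sqrt (hv k)]
      · simp
    · intro l hl hlk
      split_ifs with ha hb
      · exact absurd (hκ ((hF l).2 hl) ((hF k).2 hk) (hb.trans ha.symm)) hlk
      all_goals simp
    · exact fun h => absurd hk h
  simp only [key]
  have : ∀ r : Fin d, ∑ a : Fin N, ∑ k ∈ F,
      (if κ k = a then v k * (g k r c * g' k r c') else 0) =
      ∑ k ∈ F, v k * (g k r c * g' k r c') := by
    intro r
    rw [Finset.sum_comm]
    refine Finset.sum_congr rfl fun k hk => ?_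
    rw [Finset.sum_eq_single ⟨κ k, hN k ((hF k).2 hk)⟩]
    · simp
    · intro a _ ha
      rw [if_neg fun h => ha (Fin.ext h.symm)]
    · simp
  simp only [this]
  rw [Finset.sum_comm, Matrix.sum_apply]
  refine Finset.sum_congr rfl fun k _ => ?_
  simp [Matrix.mul_apply, Finset.mul_sum]

theorem truncRows_frameMat_mem_stiefelFin (hv : ∀ k, 0 ≤ v k) (hF : ∀ k, v k ≠ 0 ↔ k ∈ F)
    (h1 : ∑ k ∈ F, v k = 1) (hκ : Set.InjOn κ {k | v k ≠ 0}) (hN : ∀ k, v k ≠ 0 → κ k < N)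
    {g : K → Matrix (Fin d) (Fin d) ℝ} (hg : ∀ k, v k ≠ 0 → (g k).transpose * g k = 1) :
    truncRows (N * d) (frameMat v κ g) ∈ stiefelFin d (N * d) := by
  change _ * _ = _
  rw [truncRows_transpose_mul hv hF hκ hN, Finset.sum_congr rfl fun k hk => by
    rw [hg k ((hF k).2 hk)], ← Finset.sum_smul, h1, one_smul]

/-- Two frames with the same weights are as close as their blocks. -/
theorem exists_frob_frame_sub_le (hv : ∀ k, 0 ≤ v k) (hF : ∀ k, v k ≠ 0 ↔ k ∈ F)
    (h1 : ∑ k ∈ F, v k = 1) (hκ : Set.InjOn κ {k | v k ≠ 0}) (hN : ∀ k, v k ≠ 0 → κ k < N)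
    (g g' : K → Matrix (Fin d) (Fin d) ℝ) (T : Matrix (Fin d) (Fin d) ℝ) :
    ∃ k, v k ≠ 0 ∧ frob (truncRows (N * d) (frameMat v κ g) * T -
      truncRows (N * d) (frameMat v κ g')) ≤ frob (g k * T - g' k) := by
  have e : truncRows (N * d) (frameMat v κ g) * T - truncRows (N * d) (frameMat v κ g') =
      truncRows (N * d) (frameMat v κ fun k => g k * T - g' k) := by
    rw [← frameMat_mul_sub fun k => (hF k).1]
    rfl
  -- The difference is itself a frame matrix with blocks `g k * T - g' k`, so its squared norm is
  -- the trace of its Gram matrix.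
  have h2 : frob (truncRows (N * d) (frameMat v κ fun k => g k * T - g' k)) ^ 2 ≤
      ∑ k ∈ F, v k * frob (g k * T - g' k) ^ 2 := by
    rw [frob_sq_eq_trace, truncRows_transpose_mul hv hF hκ hN, Matrix.trace_sum]
    simp [frob_sq_eq_trace, Matrix.trace_smul]
  obtain ⟨k, hk, hle⟩ := exists_le_of_le_sum_mul
    (fun k hk => lt_of_le_of_ne (hv k) ((hF k).2 hk).symm) h1 h2
  refine ⟨k, (hF k).2 hk, ?_⟩
  rw [e]
  exact le_of_pow_le_pow_left₀ two_ne_zero (frob_nonneg _) hle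

variable {g : K → K → Matrix (Fin d) (Fin d) ℝ}

theorem avgMat_eq_sum (hF : ∀ k, v k ≠ 0 → k ∈ F) (g : K → K → Matrix (Fin d) (Fin d) ℝ) :
    avgMat v κ g =
      ∑ i ∈ F, v i • (frameMat v κ (fun k => g k i) * (frameMat v κ fun k => g k i).transpose) :=
  finsum_eq_sum_of_support_subset _ fun k hk => hF k fun h0 => hk (by simp [h0])

theorem padSq_truncSq_avgMat (hF : ∀ k, v k ≠ 0 → k ∈ F) (hN : ∀ k, v k ≠ 0 → κ k < N)
    (g : K → K → Matrix (Fin d) (Fin d) ℝ) :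
    padSq (N * d) (truncSq (N * d) (avgMat v κ g)) = avgMat v κ g := by
  ext m m'
  unfold padSq truncSq
  split_ifs with h
  · rfl
  · rw [avgMat_eq_sum hF, Matrix.sum_apply]
    symm
    refine Finset.sum_eq_zero fun i _ => ?_
    rw [Matrix.smul_apply, Matrix.mul_apply, Finset.sum_eq_zero, smul_zero]
    intro c _
    rw [Matrix.transpose_apply]
    rcases not_and_or.1 h with h | h
    · rw [frameMat_apply_eq_zero hN _ (not_lt.1 h), zero_mul]
    · rw [frameMat_apply_eq_zero hN _ (not_lt.1 h), mul_zero]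

/-- If the blocks satisfy an approximate cocycle condition, the average lies in the thickened
Grassmannian. -/
theorem truncSq_avgMat_mem_thickGrassFin {ε : ℝ≥0∞} (hv : ∀ k, 0 ≤ v k)
    (hF : ∀ k, v k ≠ 0 ↔ k ∈ F) (h1 : ∑ k ∈ F, v k = 1) (hκ : Set.InjOn κ {k | v k ≠ 0})
    (hN : ∀ k, v k ≠ 0 → κ k < N)
    (hg : ∀ k i, v k ≠ 0 → v i ≠ 0 → g k i ∈ Matrix.orthogonalGroup (Fin d) ℝ)
    (hε : ∀ k i j, v k ≠ 0 → v i ≠ 0 → v j ≠ 0 → Near ε (g k i * g i j) (g k j)) :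
    truncSq (N * d) (avgMat v κ g) ∈ thickGrassFin d (sqrtTwo * ε) (N * d) := by
  -- The projection of any index `j` of non-zero weight serves as the nearby point of the
  -- Grassmannian.
  obtain ⟨j, hj⟩ : F.Nonempty := by
    rw [Finset.nonempty_iff_ne_empty]
    rintro rfl
    simp at h1
  have hjv := (hF j).2 hj
  let M i := truncRows (N * d) (frameMat v κ fun k => g k i)
  have hM : ∀ i, v i ≠ 0 → M i ∈ stiefelFin d (N * d) := fun i hi =>
    truncRows_frameMat_mem_stiefelFin hv hF h1 hκ hN fun k hk =>
      (Matrix.mem_orthogonalGroup_iff' _ _).1 (hg k i hk hi)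
  refine ⟨M j * (M j).transpose, mul_transpose_mem_grassFin (hM j hjv), ?_⟩
  have e : truncSq (N * d) (avgMat v κ g) - M j * (M j).transpose =
      ∑ i ∈ F, v i • (M i * (M i).transpose - M j * (M j).transpose) := by
    simp only [smul_sub, Finset.sum_sub_distrib, ← Finset.sum_smul, h1, one_smul]
    congr 1
    rw [avgMat_eq_sum fun k => (hF k).1]
    ext a b
    simp [truncSq, Matrix.sum_apply, M, Matrix.mul_apply, truncRows]
  obtain ⟨i, hi, hle⟩ := exists_le_of_le_sum_mul
    (fun k hk => lt_of_le_of_ne (hv k) ((hF k).2 hk).symm) h1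
    ((congrArg frob e).le.trans (frob_sum_smul_le F v (fun k _ => hv k) _))
  have hiv := (hF i).2 hi
  -- The change of basis `g i j` turns block `k` of the difference of frames into the defect `g k i
  -- * g i j - g k j` of the cocycle condition.
  obtain ⟨k, hk, hle'⟩ := exists_frob_frame_sub_le hv hF h1 hκ hN (fun k => g k i)
    (fun k => g k j) (g i j)
  refine (hε k i j hk hiv hjv).of_frob_le (Real.sqrt_pos.2 two_pos) (hle.trans ?_)
  exact (frob_mul_transpose_sub_le (hM i hiv) (hM j hjv) ⟨g i j, hg i j hiv hjv⟩).trans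
    (mul_le_mul_of_nonneg_left hle' (Real.sqrt_nonneg _))

end Frames

/-- Continuity is local, and near each point the map factors through a single stage, whose inclusion
in the limit is continuous. -/
theorem DirUnion.continuous_of_eventually {X Z : Type*} [TopologicalSpace X] {Y : ℕ → Type*}
    [∀ n, TopologicalSpace (Y n)] {e : ∀ n, Y n → Z} {S : ∀ n, Set (Y n)} {f : X → DirUnion e S}
    (h : ∀ x, ∃ n, ∃ g : X → Y n, Continuous g ∧
      ∀ᶠ x' in 𝓝 x, g x' ∈ S n ∧ e n (g x') = (f x').1) : Continuous f := by
  refine continuous_iff_continuousAt.2 fun x => ?_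
  obtain ⟨n, g, hg, hx⟩ := h x
  have hof : Continuous (DirUnion.of e S n) :=
    continuous_iSup_rng (i := n) continuous_coinduced_rng
  refine ContinuousOn.continuousAt (s := {x' | g x' ∈ S n ∧ e n (g x') = (f x').1}) ?_ hx
  rw [continuousOn_iff_continuous_domRestrict]
  have : Continuous fun x' : {x' | g x' ∈ S n ∧ e n (g x') = (f x').1} =>
      DirUnion.of e S n ⟨g x', x'.2.1⟩ :=
    hof.comp ((hg.comp continuous_subtype_val).subtype_mk _)
  refine this.congr fun x' => Subtype.ext x'.2.2

/-- Used at both ends of a homotopy, where one copy of the doubled index set has weight zero and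
drops out. -/
theorem avgMat_eq_avgMat_comp {K I : Type*} {d : ℕ} [NeZero d] {v : K → ℝ} (κ : K → ℕ)
    (g : K → K → Matrix (Fin d) (Fin d) ℝ) {e : I → K} (he : Function.Injective e)
    (hv : ∀ k, k ∉ Set.range e → v k = 0) :
    avgMat v κ g = avgMat (v ∘ e) (κ ∘ e) fun k i => g (e k) (e i) := by
  have hframe : ∀ i, frameMat v κ (fun k => g k (e i)) =
      frameMat (v ∘ e) (κ ∘ e) fun k => g (e k) (e i) := by
    intro i
    ext m c
    exact finsum_eq_finsum_comp he fun k hk => by simp [hv k hk]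
  unfold avgMat
  rw [finsum_eq_finsum_comp he fun k hk => by simp [hv k hk]]
  exact finsum_congr fun i => by rw [hframe]; rfl

theorem tsupport_subset_tsupport_of_zero {X : Type*} [TopologicalSpace X] {f g : X → ℝ}
    (h : ∀ x, g x = 0 → f x = 0) : tsupport f ⊆ tsupport g :=
  closure_mono fun x hx h0 => hx (h x h0)

theorem lt_sup_succ {K : Type*} (κ : K → ℕ) {F : Finset K} {k : K} (hk : k ∈ F) :
    κ k < F.sup κ + 1 :=
  Nat.lt_succ_of_le (Finset.le_sup hk)

/-! ### Continuity of the averaged projections -/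

section Cocycles

variable {B X K : Type*} [TopologicalSpace B] [TopologicalSpace X] {W : K → Opens B} {d : ℕ}
  {ε : ℝ≥0∞}

open Classical in
/-- The functions `Ω i j` extended by zero. -/
noncomputable def Cochain.extend (Ω : Cochain W d) (i j : K) (y : B) :
    Matrix (Fin d) (Fin d) ℝ :=
  if h : y ∈ W i ∧ y ∈ W j then (Ω.val i j ⟨y, h⟩ : Matrix (Fin d) (Fin d) ℝ) else 0

theorem Cochain.extend_apply (Ω : Cochain W d) {i j : K} {y : B} (hi : y ∈ W i) (hj : y ∈ W j) :
    Ω.extend i j y = Ω.val i j ⟨y, hi, hj⟩ :=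
  dif_pos ⟨hi, hj⟩

theorem Cochain.continuousAt_extend (Ω : Cochain W d) {i j : K} {y : B} (hi : y ∈ W i)
    (hj : y ∈ W j) : ContinuousAt (Ω.extend i j) y := by
  refine ContinuousOn.continuousAt (s := (W i ⊓ W j : Opens B)) ?_
    ((W i ⊓ W j).isOpen.mem_nhds ⟨hi, hj⟩)
  rw [continuousOn_iff_continuous_domRestrict]
  exact (continuous_subtype_val.comp (Ω.val i j).continuous).congr
    fun x => (Ω.extend_apply x.2.1 x.2.2).symm

theorem Cochain.continuousAt_extend_apply (Ω : Cochain W d) {i j : K} {y : B} (hi : y ∈ W i)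
    (hj : y ∈ W j) (r c : Fin d) : ContinuousAt (fun y => Ω.extend i j y r c) y :=
  (continuous_apply_apply r c).continuousAt.comp (Ω.continuousAt_extend hi hj)

theorem ApproxCocycle.extend_mem (Ω : ApproxCocycle W d ε) {i j : K} {y : B} (hi : y ∈ W i)
    (hj : y ∈ W j) : Ω.extend i j y ∈ Matrix.orthogonalGroup (Fin d) ℝ := by
  rw [Ω.extend_apply hi hj]
  exact (Ω.val i j _).2

theorem ApproxCocycle.near_extend (Ω : ApproxCocycle W d ε) {i j k : K} {y : B} (hi : y ∈ W i)
    (hj : y ∈ W j) (hk : y ∈ W k) :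
    Near ε (Ω.extend i j y * Ω.extend j k y) (Ω.extend i k y) := by
  rw [Ω.extend_apply hi hj, Ω.extend_apply hj hk, Ω.extend_apply hi hk]
  exact Ω.near i j k y hi hj hk

variable [NeZero d]

/-- Each summand only has to be checked on the closed support of `w k`, which lies in the open set
`W k`, where the block is continuous. Local finiteness handles the sum. -/
theorem continuous_frameMat_subtype (w : PartitionOfUnity K B)
    (hw : w.IsSubordinate fun k => (W k : Set B)) (κ : K → ℕ) (Ω : Cochain W d) (i : K) :
    Continuous fun y : W i => frameMat (fun k => w k y) κ fun k => Ω.extend k i y := by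
  refine continuous_pi fun m => continuous_pi fun c => ?_
  refine continuous_finsum (fun k => ?_)
    ((w.locallyFinite.preimage_continuous continuous_subtype_val).subset fun k y hy h0 => hy ?_)
  · split_ifs
    · refine continuous_of_tsupport fun y hy => ?_
      have hy' : (y : B) ∈ tsupport (w k) := by
        exact tsupport_subset_tsupport_of_zero (fun z h0 => by simp [h0])
          (tsupport_comp_subset_preimage (fun z => Real.sqrt (w k z))
            (f := Subtype.val) continuous_subtype_val (tsupport_mul_subset_left hy))
      exact ((w k).continuous.comp continuous_subtype_val).sqrt.continuousAt.mul
        (ContinuousAt.comp (f := Subtype.val) (x := y)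
          (Ω.continuousAt_extend_apply (hw k hy') y.2 _ c) continuous_subtype_val.continuousAt)
    · exact continuous_const
  · have h0' : w k y = 0 := h0
    simp [h0']

theorem continuous_avgMat (p : C(X, B)) (w : PartitionOfUnity K X)
    (hw : w.IsSubordinate fun k => p ⁻¹' (W k : Set B)) (κ : K → ℕ) (Ω : Cochain W d) :
    Continuous fun x => avgMat (fun k => w k x) κ fun k i => Ω.extend k i (p x) := by
  refine continuous_pi fun m => continuous_pi fun m' => ?_
  -- The weight `w i` is split as `√(w i) * √(w i)`, one factor for each copy of the frame. The
  -- entries `A` then vanish off the closed supports of `w i` and `w k`, and so are continuous on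
  -- all of `X`.
  let A (i k : K) (m : ℕ) (c : Fin d) (x : X) : ℝ := if κ k = m / d then
    Real.sqrt (w i x) * Real.sqrt (w k x) * Ω.extend k i (p x) (Fin.ofNat d m) c else 0
  have hA : ∀ i k m c, Continuous (A i k m c) := by
    intro i k m c
    by_cases h : κ k = m / d
    · simp only [A, h, if_true]
      refine continuous_of_tsupport fun x hx => ?_
      have hx' := tsupport_mul_subset_left hx
      have hi : x ∈ tsupport (w i) := tsupport_subset_tsupport_of_zero (fun z h0 => by simp [h0])
        (tsupport_mul_subset_left hx')
      have hk : x ∈ tsupport (w k) := tsupport_subset_tsupport_of_zero (fun z h0 => by simp [h0])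
        (tsupport_mul_subset_right hx')
      exact ((w i).continuous.sqrt.mul (w k).continuous.sqrt).continuousAt.mul
        (ContinuousAt.comp (f := p) (x := x)
          (Ω.continuousAt_extend_apply (hw k hk) (hw i hi) _ c) p.continuous.continuousAt)
    · simp only [A, h, if_false]
      exact continuous_const
  have hsum : ∀ i m c, Continuous fun x => ∑ᶠ k, A i k m c x := fun i m c =>
    continuous_finsum (fun k => hA i k m c)
      (w.locallyFinite.subset fun k x hx h0 => hx (by simp [A, h0]))
  have hmain : Continuous fun x => ∑ᶠ i, ∑ c, (∑ᶠ k, A i k m c x) * ∑ᶠ k, A i k m' c x :=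
    continuous_finsum
      (fun i => continuous_finsetSum _ fun c _ => (hsum i m c).mul (hsum i m' c))
      (w.locallyFinite.subset fun i x hx h0 => hx (by simp [A, h0]))
  refine hmain.congr fun x => ?_
  have hF : ∀ k, w k x ≠ 0 → k ∈ w.finsupport x := fun k hk => (w.mem_finsupport x).2 hk
  rw [avgMat_eq_sum hF, Matrix.sum_apply,
    finsum_eq_sum_of_support_subset (s := w.finsupport x) _ fun i hi => hF i fun h0 => hi (by
      simp [A, h0])]
  refine Finset.sum_congr rfl fun i _ => ?_
  have hfr : ∀ m c, ∑ᶠ k, A i k m c x =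
      Real.sqrt (w i x) * frameMat (fun k => w k x) κ (fun k => Ω.extend k i (p x)) m c := by
    intro m c
    rw [frameMat, mul_finsum]
    refine finsum_congr fun k => ?_
    simp only [A]
    split_ifs <;> ring
  rw [Matrix.smul_apply, Matrix.mul_apply, smul_eq_mul, Finset.mul_sum]
  refine Finset.sum_congr rfl fun c _ => ?_
  rw [hfr, hfr, mul_mul_mul_comm, Real.mul_self_sqrt (w.nonneg i x), Matrix.transpose_apply]

/-- The averaged projections of an approximate cocycle form a continuous map to the thickened
Grassmannian. The enumeration `κ` only has to be injective where the weights do not vanish. -/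
theorem exists_continuousMap_avgMat (p : C(X, B)) (w : PartitionOfUnity K X)
    (hw : w.IsSubordinate fun k => p ⁻¹' (W k : Set B)) (κ : K → ℕ)
    (hκ : ∀ x, Set.InjOn κ {k | w k x ≠ 0}) (Ω : ApproxCocycle W d ε) :
    ∃ f : C(X, ThickGrass d (sqrtTwo * ε)),
      ∀ x, (f x).1 = avgMat (fun k => w k x) κ fun k i => Ω.extend k i (p x) := by
  have hmem : ∀ {k x}, w k x ≠ 0 → p x ∈ W k := fun {k x} h => hw k (subset_tsupport _ h)
  have key : ∀ (N : ℕ) (x : X), (∀ k, w k x ≠ 0 → κ k < N) →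
      truncSq (N * d) (avgMat (fun k => w k x) κ fun k i => Ω.extend k i (p x)) ∈
        thickGrassFin d (sqrtTwo * ε) (N * d) ∧
      padSq (N * d) (truncSq (N * d)
        (avgMat (fun k => w k x) κ fun k i => Ω.extend k i (p x))) =
        avgMat (fun k => w k x) κ fun k i => Ω.extend k i (p x) := by
    intro N x hN
    have hF : ∀ k, w k x ≠ 0 ↔ k ∈ w.finsupport x := fun k => (w.mem_finsupport x).symm
    exact ⟨truncSq_avgMat_mem_thickGrassFin (fun k => w.nonneg k x) hF
      (w.sum_finsupport (Set.mem_univ x)) (hκ x) hN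
      (fun k i hk hi => Ω.extend_mem (hmem hk) (hmem hi))
      (fun k i j hk hi hj => Ω.near_extend (hmem hk) (hmem hi) (hmem hj)),
      padSq_truncSq_avgMat (fun k => (hF k).1) hN _⟩
  refine ⟨⟨fun x => ⟨avgMat (fun k => w k x) κ fun k i => Ω.extend k i (p x), _, _,
    key _ x fun k hk => lt_sup_succ κ ((w.mem_finsupport x).2 hk)⟩, ?_⟩, fun x => rfl⟩
  -- The indices with `x` in the closed support, unlike those with non-zero weight at `x`, contain
  -- all indices that are active near `x`; so one stage serves a whole neighbourhood.
  refine DirUnion.continuous_of_eventually fun x => ⟨((w.fintsupport x).sup κ + 1) * d,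
    fun x' => truncSq _ (avgMat (fun k => w k x') κ fun k i => Ω.extend k i (p x')), ?_, ?_⟩
  · refine continuous_pi fun a => continuous_pi fun b => ?_
    exact (continuous_apply_apply (a : ℕ) (b : ℕ)).comp (continuous_avgMat p w hw κ Ω.toCochain)
  · filter_upwards [w.eventually_finsupport_subset x] with x' hx'
    exact key _ x' fun k hk => lt_sup_succ κ (hx' ((w.mem_finsupport x').2 hk))

end Cocycles

/-! ### Comparison with `trivMatrix` and `avMatrix` -/

section LocalTrivializations

variable {B I : Type*} [TopologicalSpace B] {U : I → Opens B} {d : ℕ} [NeZero d] {ε : ℝ≥0∞}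

theorem trivMatrix_eq_frameMat {φ : PartitionOfUnity I B}
    (hφ : φ.IsSubordinate fun i => (U i : Set B)) (ι : I ↪ ℕ) (Ω : Cochain U d) (i : I)
    (y : U i) :
    trivMatrix φ ι Ω i y = frameMat (fun k => φ k y) ι fun k => Ω.extend k i y := by
  ext m c
  refine finsum_congr fun j => ?_
  by_cases hm : ι j = m / d
  · by_cases hy : (y : B) ∈ U j
    · rw [dif_pos ⟨hm, hy⟩, if_pos hm]
      change Real.sqrt (φ j y) * (Ω.val i j ⟨y, y.2, hy⟩ : Matrix (Fin d) (Fin d) ℝ).transpose _ c =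
        Real.sqrt (φ j y) * Ω.extend j i y _ c
      rw [Ω.extend_apply hy y.2, Ω.symm i j y y.2 hy]
      simp only [Matrix.UnitaryGroup.inv_val, Matrix.star_eq_conjTranspose,
        Matrix.conjTranspose_eq_transpose_of_trivial, Matrix.transpose_transpose]
    · have h0 : φ j y = 0 := by_contra fun h => hy (hφ j (subset_tsupport _ h))
      rw [dif_neg fun h => hy h.2, if_pos hm]
      change 0 = Real.sqrt (φ j y) * Ω.extend j i y _ c
      rw [h0, Real.sqrt_zero, zero_mul]
  · rw [dif_neg fun h => hm h.1, if_neg hm]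

/-- The cocycle itself provides the transition functions: the blocks of `Φ_i Ω_ij - Φ_j` are `√φ_k
(Ω_ki Ω_ij - Ω_kj)`. -/
theorem exists_approxLocalTriv {φ : PartitionOfUnity I B}
    (hφ : φ.IsSubordinate fun i => (U i : Set B)) (ι : I ↪ ℕ) (Ω : ApproxCocycle U d ε) :
    ∃ Φ : ApproxLocalTriv U d ε,
      ∀ (i : I) (y : U i), (Φ.val i y).1 = trivMatrix φ ι Ω.toCochain i y := by
  have hmem : ∀ {k y}, φ k y ≠ 0 → y ∈ U k := fun {k y} h => hφ k (subset_tsupport _ h)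
  have hF : ∀ y k, φ k y ≠ 0 ↔ k ∈ φ.finsupport y := fun y k => (φ.mem_finsupport y).symm
  have key : ∀ (N : ℕ) (i : I) (y : U i), (∀ k, φ k y ≠ 0 → ι k < N) →
      truncRows (N * d) (frameMat (fun k => φ k y) ι fun k => Ω.extend k i y) ∈
        stiefelFin d (N * d) := fun N i y hN =>
    truncRows_frameMat_mem_stiefelFin (fun k => φ.nonneg k y) (hF y)
      (φ.sum_finsupport (Set.mem_univ _)) ι.injective.injOn hN fun k hk =>
      (Matrix.mem_orthogonalGroup_iff' _ _).1 (Ω.extend_mem (hmem hk) y.2)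
  refine ⟨⟨fun i => ⟨fun y => ⟨frameMat (fun k => φ k y) ι fun k => Ω.extend k i y, _, _,
    key _ i y fun k hk => lt_sup_succ ι ((hF y k).1 hk),
    padRows_truncRows_frameMat (fun k hk => lt_sup_succ ι ((hF y k).1 hk)) _⟩, ?_⟩,
    fun i j => ⟨Ω.val i j, fun y hi hj => ?_⟩⟩,
    fun i y => (trivMatrix_eq_frameMat hφ ι Ω.toCochain i y).symm⟩
  · refine DirUnion.continuous_of_eventually fun y => ⟨((φ.fintsupport y).sup ι + 1) * d,
      fun y' => truncRows _ (frameMat (fun k => φ k y') ι fun k => Ω.extend k i y'), ?_, ?_⟩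
    · refine continuous_pi fun a => continuous_pi fun c => ?_
      exact (continuous_apply_apply (a : ℕ) c).comp
        (continuous_frameMat_subtype φ hφ ι Ω.toCochain i)
    · filter_upwards [continuous_subtype_val.continuousAt.eventually
        (φ.eventually_finsupport_subset (y : B))] with y' hy'
      have hN : ∀ k, φ k y' ≠ 0 → ι k < (φ.fintsupport y).sup ι + 1 := fun k hk =>
        lt_sup_succ ι (hy' ((hF y' k).1 hk))
      exact ⟨key _ i y' hN, padRows_truncRows_frameMat hN _⟩
  · have hN : ∀ k, φ k y ≠ 0 → ι k < (φ.finsupport y).sup ι + 1 := fun k hk =>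
      lt_sup_succ ι ((hF y k).1 hk)
    change Near ε (frameMat (fun k => φ k y) ι (fun k => Ω.extend k i y) * _)
      (frameMat (fun k => φ k y) ι fun k => Ω.extend k j y)
    obtain ⟨k, hk, hle⟩ := exists_frob_frame_sub_le (fun k => φ.nonneg k y) (hF y)
      (φ.sum_finsupport (Set.mem_univ _)) ι.injective.injOn hN (fun k => Ω.extend k i y)
      (fun k => Ω.extend k j y) (Ω.extend i j y)
    have hnear := (Ω.near_extend (hmem hk) hi hj).of_frob_le one_pos
      (hle.trans_eq (one_mul _).symm)
    rw [ENNReal.ofReal_one, one_mul] at hnear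
    have hpad := hnear.padRows
    rw [padRows_truncRows_frameMat hN] at hpad
    convert hpad using 1
    rw [← Ω.extend_apply hi hj]
    nth_rewrite 1 [← padRows_truncRows_frameMat hN]
    ext m c
    simp only [Matrix.mul_apply, padRows]
    split_ifs
    · rfl
    · simp

theorem avMatrix_eq_avgMat {φ : PartitionOfUnity I B}
    (hφ : φ.IsSubordinate fun i => (U i : Set B)) (ι : I ↪ ℕ) (Ω : Cochain U d)
    {Φ : ApproxLocalTriv U d ε}
    (hΦ : ∀ (i : I) (y : U i), (Φ.val i y).1 = trivMatrix φ ι Ω i y) (y : B) :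
    avMatrix φ Φ y = avgMat (fun k => φ k y) ι fun k i => Ω.extend k i y := by
  refine finsum_congr fun i => ?_
  by_cases hy : y ∈ U i
  · rw [dif_pos hy, hΦ, trivMatrix_eq_frameMat hφ]
  · have h0 : φ i y = 0 := by_contra fun h => hy (hφ i (subset_tsupport _ h))
    rw [dif_neg hy]
    change 0 = φ i y • _
    rw [h0, zero_smul]

end LocalTrivializations

/-! ### Cocycles on the doubled cover -/

section Constructions

variable {B I : Type*} [TopologicalSpace B] {U : I → Opens B} {d : ℕ} {ε : ℝ≥0∞}

theorem Cochain.extend_congr {K : Type*} {W : K → Opens B} {Ω : Cochain U d} {Λ : Cochain W d}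
    {i j : I} {k l : K} (hik : U i = W k) (hjl : U j = W l)
    (h : ∀ y hi hj hk hl, Ω.val i j ⟨y, hi, hj⟩ = Λ.val k l ⟨y, hk, hl⟩) (y : B) :
    Ω.extend i j y = Λ.extend k l y := by
  by_cases hy : y ∈ U i ∧ y ∈ U j
  · rw [Ω.extend_apply hy.1 hy.2, Λ.extend_apply (hik ▸ hy.1) (hjl ▸ hy.2)]
    exact congrArg Subtype.val (h y hy.1 hy.2 (hik ▸ hy.1) (hjl ▸ hy.2))
  · rw [Cochain.extend, dif_neg hy, Cochain.extend, dif_neg (by rwa [← hik, ← hjl])]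

/-- An approximate cocycle is one for every larger bound. -/
def ApproxCocycle.widen {δ : ℝ≥0∞} (h : ε ≤ δ) (Ω : ApproxCocycle U d ε) :
    ApproxCocycle U d δ where
  toCochain := Ω.toCochain
  near i j k y hi hj hk := (Ω.near i j k y hi hj hk).mono h

/-- Two refinements define a refinement of the doubled cover. -/
def Refinement.sum {J : Type*} {V : J → Opens B} (μ ν : Refinement V U) :
    Refinement (Sum.elim V V) U where
  idx := Sum.elim μ.idx ν.idx
  le := fun j => match j with
    | Sum.inl j => μ.le j
    | Sum.inr j => ν.le j

/-- The identity refinement. -/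
def Refinement.id (U : I → Opens B) : Refinement U U := ⟨fun i => i, fun _ => le_rfl⟩

theorem Refinement.extend_sum_id_inl (Ω : ApproxCocycle U d ε) (k i : I) (y : B) :
    (((Refinement.id U).sum (Refinement.id U)).pullback Ω).extend (Sum.inl k) (Sum.inl i) y =
      Ω.extend k i y :=
  Cochain.extend_congr rfl rfl (fun _ _ _ _ _ => rfl) y

theorem Refinement.extend_sum_id_inr (Ω : ApproxCocycle U d ε) (k i : I) (y : B) :
    (((Refinement.id U).sum (Refinement.id U)).pullback Ω).extend (Sum.inr k) (Sum.inr i) y =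
      Ω.extend k i y :=
  Cochain.extend_congr rfl rfl (fun _ _ _ _ _ => rfl) y

/-- The action of a family `Θ` of maps to `O(d)` on approximate cocycles. -/
def ApproxCocycle.gauge (Θ : ∀ i, C(U i, OGrp d)) (Ω : ApproxCocycle U d ε) :
    ApproxCocycle U d ε where
  val i j := ⟨fun y => Θ i ⟨y, y.2.1⟩ * Ω.val i j y * (Θ j ⟨y, y.2.2⟩)⁻¹, by
    have hi : Continuous fun y : ↥(U i ⊓ U j) => Θ i ⟨y, y.2.1⟩ :=
      (Θ i).continuous.comp (continuous_subtype_val.subtype_mk _)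
    have hj : Continuous fun y : ↥(U i ⊓ U j) => Θ j ⟨y, y.2.2⟩ :=
      (Θ j).continuous.comp (continuous_subtype_val.subtype_mk _)
    exact (hi.mul (Ω.val i j).continuous).mul hj.inv⟩
  symm i j y hi hj := by
    simp only [ContinuousMap.coe_mk]
    rw [Ω.symm i j y hi hj]
    group
  near i j k y hi hj hk := by
    -- The inner factors `Θ j` cancel, and the outer ones preserve the Frobenius norm.
    have h := (Ω.near i j k y hi hj hk).mul_orthogonal (Θ i ⟨y, hi⟩) (Θ k ⟨y, hk⟩)⁻¹
    have e : Θ i ⟨y, hi⟩ * Ω.val i j ⟨y, hi, hj⟩ * (Θ j ⟨y, hj⟩)⁻¹ *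
        (Θ j ⟨y, hj⟩ * Ω.val j k ⟨y, hj, hk⟩ * (Θ k ⟨y, hk⟩)⁻¹) =
        Θ i ⟨y, hi⟩ * (Ω.val i j ⟨y, hi, hj⟩ * Ω.val j k ⟨y, hj, hk⟩) * (Θ k ⟨y, hk⟩)⁻¹ := by
      group
    simp only [ContinuousMap.coe_mk]
    rw [e]
    exact h

/-- Two nearby approximate cocycles as parts of one on the doubled cover. -/
def ApproxCocycle.sum {δ : ℝ≥0∞} (Ω Λ : ApproxCocycle U d ε)
    (h : ∀ (i j : I) (y : B) (hi : y ∈ U i) (hj : y ∈ U j),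
      Near δ (Ω.val i j ⟨y, hi, hj⟩ : Matrix (Fin d) (Fin d) ℝ) (Λ.val i j ⟨y, hi, hj⟩)) :
    ApproxCocycle (Sum.elim U U) d (ε + δ) where
  val k l := match k, l with
    | Sum.inl i, Sum.inl j => Ω.val i j
    | Sum.inl i, Sum.inr j => Ω.val i j
    | Sum.inr i, Sum.inl j => Ω.val i j
    | Sum.inr i, Sum.inr j => Λ.val i j
  symm k l y hk hl := match k, l with
    | Sum.inl i, Sum.inl j => Ω.symm i j y hk hl
    | Sum.inl i, Sum.inr j => Ω.symm i j y hk hl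
    | Sum.inr i, Sum.inl j => Ω.symm i j y hk hl
    | Sum.inr i, Sum.inr j => Λ.symm i j y hk hl
  near a b c y ha hb hc := by
    -- As all mixed entries come from `Ω`, a triple that is not purely `Λ` contains at most one
    -- entry of `Λ`. Replacing it by `Ω` costs `δ` only once.
    have right : ∀ (i j k : I) (hi : y ∈ U i) (hj : y ∈ U j) (hk : y ∈ U k),
        Near δ ((Ω.val i j ⟨y, hi, hj⟩ * Λ.val j k ⟨y, hj, hk⟩ : OGrp d) : Matrix (Fin d) (Fin d) ℝ)
          ((Ω.val i j ⟨y, hi, hj⟩ * Ω.val j k ⟨y, hj, hk⟩ : OGrp d) :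
            Matrix (Fin d) (Fin d) ℝ) := by
      intro i j k hi hj hk
      simpa using (h j k y hj hk).symm.mul_orthogonal (Ω.val i j ⟨y, hi, hj⟩) 1
    have left : ∀ (i j k : I) (hi : y ∈ U i) (hj : y ∈ U j) (hk : y ∈ U k),
        Near δ ((Λ.val i j ⟨y, hi, hj⟩ * Ω.val j k ⟨y, hj, hk⟩ : OGrp d) : Matrix (Fin d) (Fin d) ℝ)
          ((Ω.val i j ⟨y, hi, hj⟩ * Ω.val j k ⟨y, hj, hk⟩ : OGrp d) :
            Matrix (Fin d) (Fin d) ℝ) := by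
      intro i j k hi hj hk
      simpa using (h i j y hi hj).symm.mul_orthogonal 1 (Ω.val j k ⟨y, hj, hk⟩)
    have hle : ε ≤ ε + δ := le_self_add
    rcases a with i | i <;> rcases b with j | j <;> rcases c with k | k
    · exact (Ω.near i j k y ha hb hc).mono hle
    · exact (Ω.near i j k y ha hb hc).mono hle
    · exact (Ω.near i j k y ha hb hc).mono hle
    · rw [add_comm]
      exact (right i j k ha hb hc).trans (Ω.near i j k y ha hb hc)
    · exact (Ω.near i j k y ha hb hc).mono hle
    · exact (Ω.near i j k y ha hb hc).trans (h i k y ha hc)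
    · rw [add_comm]
      exact (left i j k ha hb hc).trans (Ω.near i j k y ha hb hc)
    · exact (Λ.near i j k y ha hb hc).mono hle

end Constructions

/-! ### Homotopies from interpolated partitions of unity -/

section Homotopies

variable {B I : Type*} [TopologicalSpace B]

/-- The two copies of `i` share the weight `(1 - t) φ_i + t φ'_i`; the parameter `s i` only decides
how it is divided, so each index may have its own schedule. -/
theorem sum_interpolate_eq_one (φ φ' : PartitionOfUnity I B) (s : I → C(unitInterval, unitInterval))
    (t : unitInterval) (y : B) :
    ∑ᶠ k : I ⊕ I, Sum.elim (fun i => (1 - (s i t : ℝ)) * ((1 - (t : ℝ)) * φ i y + t * φ' i y))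
      (fun i => (s i t : ℝ) * ((1 - (t : ℝ)) * φ i y + t * φ' i y)) k = 1 := by
  classical
  obtain ⟨F, hF, hF'⟩ : ∃ F : Finset I, φ.finsupport y ⊆ F ∧ φ'.finsupport y ⊆ F :=
    ⟨_, Finset.subset_union_left, Finset.subset_union_right⟩
  have h0 : ∀ i, i ∉ F → φ i y = 0 ∧ φ' i y = 0 := fun i hi =>
    ⟨by_contra fun h => hi (hF ((φ.mem_finsupport y).2 h)),
      by_contra fun h => hi (hF' ((φ'.mem_finsupport y).2 h))⟩
  rw [finsum_eq_sum_of_support_subset (s := F.disjSum F), Finset.sum_disjSum]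
  · simp only [Sum.elim_inl, Sum.elim_inr]
    rw [← Finset.sum_add_distrib]
    simp only [← add_mul, sub_add_cancel, one_mul]
    rw [Finset.sum_add_distrib, ← Finset.mul_sum, ← Finset.mul_sum,
      φ.sum_finsupport' (Set.mem_univ y) hF, φ'.sum_finsupport' (Set.mem_univ y) hF']
    ring
  · rintro (i | i) hi
    · simp only [Finset.mem_coe, Finset.inl_mem_disjSum]
      by_contra h
      simp [h0 i h] at hi
    · simp only [Finset.mem_coe, Finset.inr_mem_disjSum]
      by_contra h
      simp [h0 i h] at hi

/-- The partition of unity on `[0, 1] × B` which moves from `φ` on the first copy of the index set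
to `φ'` on the second copy, with the speed of the `i`-th transfer prescribed by `s i`. -/
noncomputable def interpolate (φ φ' : PartitionOfUnity I B)
    (s : I → C(unitInterval, unitInterval)) : PartitionOfUnity (I ⊕ I) (unitInterval × B) where
  toFun := Sum.elim
    (fun i => ⟨fun x => (1 - (s i x.1 : ℝ)) * ((1 - (x.1 : ℝ)) * φ i x.2 + x.1 * φ' i x.2),
      by fun_prop⟩)
    (fun i => ⟨fun x => (s i x.1 : ℝ) * ((1 - (x.1 : ℝ)) * φ i x.2 + x.1 * φ' i x.2),
      by fun_prop⟩)
  locallyFinite' := by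
    have h : LocallyFinite fun i => (Prod.snd : unitInterval × B → B) ⁻¹'
        (Function.support (φ i) ∪ Function.support (φ' i)) := by
      refine LocallyFinite.preimage_continuous (fun y => ?_) continuous_snd
      obtain ⟨u, hu, hu'⟩ := φ.locallyFinite y
      obtain ⟨v, hv, hv'⟩ := φ'.locallyFinite y
      refine ⟨u ∩ v, Filter.inter_mem hu hv, (hu'.union hv').subset ?_⟩
      rintro i ⟨z, hz | hz, hzu, hzv⟩
      · exact Or.inl ⟨z, hz, hzu⟩
      · exact Or.inr ⟨z, hz, hzv⟩
    refine (h.sumElim h).subset ?_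
    rintro (i | i) x hx <;> by_contra h0 <;> simp_all
  nonneg' := by
    rintro (i | i) x
    · exact mul_nonneg (sub_nonneg.2 (s i x.1).2.2) (add_nonneg
        (mul_nonneg (sub_nonneg.2 x.1.2.2) (φ.nonneg i _)) (mul_nonneg x.1.2.1 (φ'.nonneg i _)))
    · exact mul_nonneg (s i x.1).2.1 (add_nonneg
        (mul_nonneg (sub_nonneg.2 x.1.2.2) (φ.nonneg i _)) (mul_nonneg x.1.2.1 (φ'.nonneg i _)))
  sum_eq_one' x _ := by
    refine (finsum_congr ?_).trans (sum_interpolate_eq_one φ φ' s x.1 x.2)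
    rintro (i | i) <;> rfl
  sum_le_one' x := by
    refine ((finsum_congr ?_).trans (sum_interpolate_eq_one φ φ' s x.1 x.2)).le
    rintro (i | i) <;> rfl

theorem interpolate_inl (φ φ' : PartitionOfUnity I B) (s : I → C(unitInterval, unitInterval))
    (i : I) (x : unitInterval × B) : interpolate φ φ' s (Sum.inl i) x =
      (1 - (s i x.1 : ℝ)) * ((1 - (x.1 : ℝ)) * φ i x.2 + x.1 * φ' i x.2) := rfl

theorem interpolate_inr (φ φ' : PartitionOfUnity I B) (s : I → C(unitInterval, unitInterval))
    (i : I) (x : unitInterval × B) : interpolate φ φ' s (Sum.inr i) x =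
      (s i x.1 : ℝ) * ((1 - (x.1 : ℝ)) * φ i x.2 + x.1 * φ' i x.2) := rfl

variable {U : I → Opens B} {d : ℕ} [NeZero d] {ε : ℝ≥0∞}

theorem interpolate_isSubordinate {φ φ' : PartitionOfUnity I B}
    (hφ : φ.IsSubordinate fun i => (U i : Set B)) (hφ' : φ'.IsSubordinate fun i => (U i : Set B))
    (s : I → C(unitInterval, unitInterval)) :
    (interpolate φ φ' s).IsSubordinate fun k => Prod.snd ⁻¹' ((Sum.elim U U k : Opens B) : Set B) := by
  have h : ∀ i (f : unitInterval × B → ℝ), (∀ x, φ i x.2 = 0 → φ' i x.2 = 0 → f x = 0) →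
      tsupport f ⊆ Prod.snd ⁻¹' (U i : Set B) := by
    intro i f hf
    refine (closure_minimal (t := Prod.snd ⁻¹' (tsupport (φ i) ∪ tsupport (φ' i))) (fun x hx => ?_)
      (((isClosed_tsupport _).union (isClosed_tsupport _)).preimage continuous_snd)).trans
      (Set.preimage_mono (Set.union_subset (hφ i) (hφ' i)))
    by_contra hx'
    simp only [Set.mem_preimage, Set.mem_union, not_or] at hx'
    exact hx (hf x (image_eq_zero_of_notMem_tsupport hx'.1)
      (image_eq_zero_of_notMem_tsupport hx'.2))
  rintro (i | i)
  · exact h i _ fun x h h' => by simp [interpolate_inl, h, h']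
  · exact h i _ fun x h h' => by simp [interpolate_inr, h, h']

/-- The map `f` is given by the averaged projections of the cochain `Ω`. -/
def IsAverage (φ : PartitionOfUnity I B) (κ : I → ℕ) (Ω : Cochain U d)
    (f : C(B, ThickGrass d ε)) : Prop :=
  ∀ y, (f y).1 = avgMat (fun k => φ k y) κ fun k i => Ω.extend k i y

theorem exists_isAverage {φ : PartitionOfUnity I B} (hφ : φ.IsSubordinate fun i => (U i : Set B))
    {κ : I → ℕ} (hκ : Function.Injective κ) (Ω : ApproxCocycle U d ε) :
    ∃ f : C(B, ThickGrass d (sqrtTwo * ε)), IsAverage φ κ Ω.toCochain f :=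
  exists_continuousMap_avgMat (ContinuousMap.id B) φ hφ κ (fun _ => hκ.injOn) Ω

/-- The homotopy is the averaged projection of `Ξ` pulled back to `[0, 1] × B`. Condition `hκκ'`
says that a block yet to finish leaving never shares its rows with one that has begun to arrive. -/
theorem homotopic_of_interpolate {φ φ' : PartitionOfUnity I B}
    (hφ : φ.IsSubordinate fun i => (U i : Set B)) (hφ' : φ'.IsSubordinate fun i => (U i : Set B))
    {Ω Λ : Cochain U d} (Ξ : ApproxCocycle (Sum.elim U U) d ε)
    (hΩ : ∀ k i y, Ξ.extend (Sum.inl k) (Sum.inl i) y = Ω.extend k i y)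
    (hΛ : ∀ k i y, Ξ.extend (Sum.inr k) (Sum.inr i) y = Λ.extend k i y)
    (s : I → C(unitInterval, unitInterval)) (hs0 : ∀ i, s i 0 = 0) (hs1 : ∀ i, s i 1 = 1)
    {κ κ' : I → ℕ} (hκ : Function.Injective κ) (hκ' : Function.Injective κ')
    (hκκ' : ∀ t i j, s i t ≠ 1 → s j t ≠ 0 → κ i ≠ κ' j)
    {f f' : C(B, ThickGrass d (sqrtTwo * ε))} (hf : IsAverage φ κ Ω f)
    (hf' : IsAverage φ' κ' Λ f') : f.Homotopic f' := by
  have hinj : ∀ x, Set.InjOn (Sum.elim κ κ') {k | interpolate φ φ' s k x ≠ 0} := by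
    have hl : ∀ i x, interpolate φ φ' s (Sum.inl i) x ≠ 0 → s i x.1 ≠ 1 := fun i x h h1 =>
      h (by simp [interpolate_inl, h1])
    have hr : ∀ i x, interpolate φ φ' s (Sum.inr i) x ≠ 0 → s i x.1 ≠ 0 := fun i x h h1 =>
      h (by simp [interpolate_inr, h1])
    rintro x (i | i) hi (j | j) hj h
    · exact congrArg _ (hκ h)
    · exact absurd h (hκκ' x.1 i j (hl i x hi) (hr j x hj))
    · exact absurd h.symm (hκκ' x.1 j i (hl j x hj) (hr i x hi))
    · exact congrArg _ (hκ' h)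
  obtain ⟨H, hH⟩ := exists_continuousMap_avgMat (ContinuousMap.snd : C(unitInterval × B, B))
    (interpolate φ φ' s) (interpolate_isSubordinate hφ hφ' s) (Sum.elim κ κ') hinj Ξ
  refine ⟨⟨H, fun y => Subtype.ext ?_, fun y => Subtype.ext ?_⟩⟩
  · change (H (0, y)).1 = _
    rw [hH, hf, avgMat_eq_avgMat_comp _ _ Sum.inl_injective]
    · congr 1
      · ext i
        simp [interpolate_inl, hs0]
      · ext k i : 2
        exact hΩ k i y
    · rintro (i | i) hi
      · exact absurd ⟨i, rfl⟩ hi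
      · simp [interpolate_inr, hs0]
  · change (H (1, y)).1 = _
    rw [hH, hf', avgMat_eq_avgMat_comp _ _ Sum.inr_injective]
    · congr 1
      · ext i
        simp [interpolate_inr, hs1]
      · ext k i : 2
        exact hΛ k i y
    · rintro (i | i) hi
      · simp [interpolate_inl, hs1]
      · exact absurd ⟨i, rfl⟩ hi

/-- If the two enumerations have disjoint images, all blocks can be moved at the same time. -/
theorem homotopic_of_disjoint {φ φ' : PartitionOfUnity I B}
    (hφ : φ.IsSubordinate fun i => (U i : Set B)) (hφ' : φ'.IsSubordinate fun i => (U i : Set B))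
    {Ω Λ : Cochain U d} (Ξ : ApproxCocycle (Sum.elim U U) d ε)
    (hΩ : ∀ k i y, Ξ.extend (Sum.inl k) (Sum.inl i) y = Ω.extend k i y)
    (hΛ : ∀ k i y, Ξ.extend (Sum.inr k) (Sum.inr i) y = Λ.extend k i y)
    {κ κ' : I → ℕ} (hκ : Function.Injective κ) (hκ' : Function.Injective κ')
    (hκκ' : ∀ i j, κ i ≠ κ' j)
    {f f' : C(B, ThickGrass d (sqrtTwo * ε))} (hf : IsAverage φ κ Ω f)
    (hf' : IsAverage φ' κ' Λ f') : f.Homotopic f' :=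
  homotopic_of_interpolate hφ hφ' Ξ hΩ hΛ (fun _ => ContinuousMap.id _) (fun _ => rfl)
    (fun _ => rfl) hκ hκ' (fun _ i j _ _ => hκκ' i j) hf hf'

/-- The blocks of any enumeration `κ` can be moved to the odd positions `2 κ + 1`: the `n`-th block
moves in the interval `[1 / (n + 2), 1 / (n + 1)]`, when all later blocks have left. -/
theorem homotopic_two_mul_add_one {φ : PartitionOfUnity I B}
    (hφ : φ.IsSubordinate fun i => (U i : Set B)) (Ω : ApproxCocycle U d ε)
    {κ : I → ℕ} (hκ : Function.Injective κ)
    {f f' : C(B, ThickGrass d (sqrtTwo * ε))} (hf : IsAverage φ κ Ω.toCochain f)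
    (hf' : IsAverage φ (fun i => 2 * κ i + 1) Ω.toCochain f') : f.Homotopic f' := by
  let a (n : ℕ) (t : unitInterval) : ℝ := ((n : ℝ) + 1) * (((n : ℝ) + 2) * t - 1)
  have ha : ∀ n, Continuous (a n) := fun n => by fun_prop
  refine homotopic_of_interpolate hφ hφ ((Refinement.id U).sum (Refinement.id U)|>.pullback Ω)
    (Refinement.extend_sum_id_inl Ω) (Refinement.extend_sum_id_inr Ω)
    (fun i => ⟨fun t => Set.projIcc 0 1 zero_le_one (a (κ i) t),
      continuous_projIcc.comp (ha _)⟩) (fun i => ?_) (fun i => ?_) hκ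
    (fun i j h => hκ (by simpa using h)) (fun t i j hi hj h => ?_) hf hf'
  · refine Set.projIcc_of_le_left zero_le_one ?_
    have : (0 : ℝ) ≤ κ i := Nat.cast_nonneg _
    simp only [a, Set.Icc.coe_zero]
    nlinarith
  · refine Set.projIcc_of_right_le zero_le_one ?_
    have : (0 : ℝ) ≤ κ i := Nat.cast_nonneg _
    simp only [a, Set.Icc.coe_one]
    nlinarith
  -- A collision `κ i = 2 * κ j + 1` would require `1 / (κ j + 2) < t < 1 / (2 * κ j + 2)`, which is
  -- impossible.
  · have h1 : a (κ i) t < 1 := by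
      by_contra! h1
      exact hi (Set.projIcc_of_right_le zero_le_one h1)
    have h0 : 0 < a (κ j) t := by
      by_contra! h0
      exact hj (Set.projIcc_of_le_left zero_le_one h0)
    have hn : (κ i : ℝ) = 2 * κ j + 1 := by exact_mod_cast h
    have hm : (0 : ℝ) ≤ κ j := Nat.cast_nonneg _
    have ht : (0 : ℝ) ≤ t := t.2.1
    have h2 : 1 < ((κ j : ℝ) + 2) * t := by
      have := pos_of_mul_pos_right h0 (by positivity)
      linarith
    have h3 : ((κ i : ℝ) + 1) * t < 1 := by
      have h4 : ((κ i : ℝ) + 2) * (((κ i : ℝ) + 1) * t) < (κ i : ℝ) + 2 := by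
        simp only [a] at h1
        linarith
      have h5 : (0 : ℝ) < (κ i : ℝ) + 2 := by positivity
      exact lt_of_mul_lt_mul_left (by rwa [mul_one]) h5.le
    rw [hn] at h3
    nlinarith [mul_nonneg hm ht]

/-- The homotopy class of the averaged projections does not depend on any choice. -/
theorem homotopic_of_isAverage {φ φ' : PartitionOfUnity I B}
    (hφ : φ.IsSubordinate fun i => (U i : Set B)) (hφ' : φ'.IsSubordinate fun i => (U i : Set B))
    {Ω Λ : ApproxCocycle U d ε} (Ξ : ApproxCocycle (Sum.elim U U) d ε)
    (hΩ : ∀ k i y, Ξ.extend (Sum.inl k) (Sum.inl i) y = Ω.extend k i y)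
    (hΛ : ∀ k i y, Ξ.extend (Sum.inr k) (Sum.inr i) y = Λ.extend k i y)
    {κ κ' : I → ℕ} (hκ : Function.Injective κ) (hκ' : Function.Injective κ')
    {f f' : C(B, ThickGrass d (sqrtTwo * ε))} (hf : IsAverage φ κ Ω.toCochain f)
    (hf' : IsAverage φ' κ' Λ.toCochain f') : f.Homotopic f' := by
  have hodd : Function.Injective fun i => 2 * κ i + 1 := fun i j h => hκ (by simpa using h)
  have hodd' : Function.Injective fun i => 2 * κ' i + 1 := fun i j h => hκ' (by simpa using h)
  have heven' : Function.Injective fun i => 2 * κ' i := fun i j h => hκ' (by simpa using h)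
  obtain ⟨f₁, hf₁⟩ := exists_isAverage hφ hodd Ω
  obtain ⟨f₂, hf₂⟩ := exists_isAverage hφ' heven' Λ
  obtain ⟨f₃, hf₃⟩ := exists_isAverage hφ' hodd' Λ
  -- The positions run through `κ`, `2 κ + 1`, `2 κ'`, `2 κ' + 1`, `κ'`. Cocycle and partition of
  -- unity change in the second move, between odd and even positions.
  refine (homotopic_two_mul_add_one hφ Ω hκ hf hf₁).trans
    ((homotopic_of_disjoint hφ hφ' Ξ hΩ hΛ hodd heven' (fun i j h => ?_) hf₁ hf₂).trans
    ((homotopic_of_disjoint hφ' hφ' ((Refinement.id U).sum (Refinement.id U)|>.pullback Λ)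
      (Refinement.extend_sum_id_inl Λ) (Refinement.extend_sum_id_inr Λ) heven' hodd'
      (fun i j h => ?_) hf₂ hf₃).trans (homotopic_two_mul_add_one hφ' Λ hκ' hf' hf₃).symm)) <;>
  omega

/-- The pullback of `Ω` to the doubled cover, transformed by `1` on the first copy and by `Θ` on the
second, restricts to `Ω` and `Λ` and keeps the bound `ε`. -/
theorem homotopic_of_cohomologous {φ φ' : PartitionOfUnity I B}
    (hφ : φ.IsSubordinate fun i => (U i : Set B)) (hφ' : φ'.IsSubordinate fun i => (U i : Set B))
    {Ω Λ : ApproxCocycle U d ε} (h : (cohomologous U d ε).r Ω Λ)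
    {κ κ' : I → ℕ} (hκ : Function.Injective κ) (hκ' : Function.Injective κ')
    {f f' : C(B, ThickGrass d (sqrtTwo * ε))} (hf : IsAverage φ κ Ω.toCochain f)
    (hf' : IsAverage φ' κ' Λ.toCochain f') : f.Homotopic f' := by
  obtain ⟨Θ, hΘ⟩ := h
  let Θ' : ∀ k, C((Sum.elim U U k : Opens B), OGrp d) := fun k => match k with
    | Sum.inl i => ContinuousMap.const _ 1
    | Sum.inr i => Θ i
  refine homotopic_of_isAverage hφ hφ'
    (((Refinement.id U).sum (Refinement.id U)|>.pullback Ω).gauge Θ') (fun k i y => ?_)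
    (fun k i y => ?_) hκ hκ' hf hf'
  · refine Cochain.extend_congr ?_ ?_ (fun y hk hi _ _ => ?_) y
    iterate 2 rfl
    change 1 * Ω.val k i ⟨y, hk, hi⟩ * 1⁻¹ = Ω.val k i ⟨y, hk, hi⟩
    simp
  · refine Cochain.extend_congr ?_ ?_ (fun y hk hi _ _ => ?_) y
    iterate 2 rfl
    exact (hΘ k i y hk hi).symm

end Homotopies

/-! ### The classifying map and its stability -/

section Classification

variable {B I : Type*} [TopologicalSpace B] {U : I → Opens B} {d : ℕ} [NeZero d] {ε : ℝ≥0∞}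

theorem exists_partitionOfUnity [T2Space B] [ParacompactSpace B] (hU : IsOpenCover U) :
    ∃ φ : PartitionOfUnity I B, φ.IsSubordinate fun i => (U i : Set B) :=
  PartitionOfUnity.exists_isSubordinate isClosed_univ _ (fun i => (U i).isOpen)
    hU.iSup_set_eq_univ.ge

theorem IsClassifying.exists_isAverage
    {cl : ApproxCohomology U d ε → HomotopyClasses B (ThickGrass d (sqrtTwo * ε))}
    (hcl : IsClassifying cl) {φ : PartitionOfUnity I B}
    (hφ : φ.IsSubordinate fun i => (U i : Set B)) (ι : I ↪ ℕ) (Ω : ApproxCocycle U d ε) :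
    ∃ f : C(B, ThickGrass d (sqrtTwo * ε)),
      IsAverage φ ι Ω.toCochain f ∧ cl Ω.cls = Quotient.mk _ f := by
  obtain ⟨Φ, hΦ, f, hf, hcl⟩ := hcl φ hφ ι Ω
  exact ⟨f, fun y => (hf y).trans (avMatrix_eq_avgMat hφ ι Ω.toCochain hΦ y), hcl⟩

theorem existsUnique_isClassifying [T2Space B] [ParacompactSpace B] [Countable I]
    (hU : IsOpenCover U) (d : ℕ) [NeZero d] (ε : ℝ≥0∞) :
    ∃! cl : ApproxCohomology U d ε → HomotopyClasses B (ThickGrass d (sqrtTwo * ε)),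
      IsClassifying cl := by
  obtain ⟨φ₀, hφ₀⟩ := exists_partitionOfUnity hU
  obtain ⟨ι₀⟩ := nonempty_embedding_nat I
  choose F hF using fun Ω : ApproxCocycle U d ε => exists_isAverage hφ₀ ι₀.injective Ω
  refine ⟨Quotient.lift (fun Ω => Quotient.mk _ (F Ω)) fun Ω Λ h => Quotient.sound
    (homotopic_of_cohomologous hφ₀ hφ₀ h ι₀.injective ι₀.injective (hF Ω) (hF Λ)), ?_, ?_⟩
  · intro φ hφ ι Ω
    obtain ⟨Φ, hΦ⟩ := exists_approxLocalTriv hφ ι Ω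
    obtain ⟨f, hf⟩ := exists_isAverage hφ ι.injective Ω
    exact ⟨Φ, hΦ, f, fun y => (hf y).trans (avMatrix_eq_avgMat hφ ι Ω.toCochain hΦ y).symm,
      Quotient.sound (homotopic_of_cohomologous hφ₀ hφ ((cohomologous U d ε).refl Ω)
        ι₀.injective ι.injective (hF Ω) hf)⟩
  -- A single choice of `φ₀` and `ι₀` already prescribes the value on every class, and a map to the
  -- thickened Grassmannian is determined by its matrices.
  · intro cl hcl
    funext x
    induction x using Quotient.inductionOn with
    | h Ω =>
      obtain ⟨f, hf, hclf⟩ := hcl.exists_isAverage hφ₀ ι₀ Ω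
      refine hclf.trans (congrArg _ (ContinuousMap.ext fun y => Subtype.ext ?_))
      rw [hf y, hF Ω y]

theorem widen_eq_widen_of_distH_lt [T2Space B] [ParacompactSpace B] [Countable I]
    (hU : IsOpenCover U)
    {cl : ApproxCohomology U d ε → HomotopyClasses B (ThickGrass d (sqrtTwo * ε))}
    (hcl : IsClassifying cl) {δ : ℝ≥0∞} {x x' : ApproxCohomology U d ε} (h : distH x x' < δ) :
    widen d (sqrtTwo_mul_le_add ε δ) (cl x) = widen d (sqrtTwo_mul_le_add ε δ) (cl x') := by
  simp only [distH, iInf_lt_iff] at h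
  obtain ⟨Ω, Λ, rfl, rfl, h⟩ := h
  obtain ⟨φ, hφ⟩ := exists_partitionOfUnity hU
  obtain ⟨ι⟩ := nonempty_embedding_nat I
  obtain ⟨f, hf, hclf⟩ := hcl.exists_isAverage hφ ι Ω
  obtain ⟨f', hf', hclf'⟩ := hcl.exists_isAverage hφ ι Λ
  rw [hclf, hclf']
  have hnear : ∀ (i j : I) (y : B) (hi : y ∈ U i) (hj : y ∈ U j),
      Near δ (Ω.val i j ⟨y, hi, hj⟩ : Matrix (Fin d) (Fin d) ℝ) (Λ.val i j ⟨y, hi, hj⟩) :=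
    fun i j y hi hj => Or.inr ((le_iSup_of_le i (le_iSup_of_le j
      (le_iSup (fun z : ↥(U i ⊓ U j) => ENNReal.ofReal (frob
        ((Ω.val i j z : Matrix (Fin d) (Fin d) ℝ) - (Λ.val i j z : Matrix (Fin d) (Fin d) ℝ))))
        ⟨y, hi, hj⟩))).trans_lt h)
  -- `IsAverage` only concerns the underlying matrices, so `hf` and `hf'` also apply to the widened
  -- maps and cocycles.
  exact Quotient.sound (homotopic_of_isAverage (Ω := Ω.widen le_self_add)
    (Λ := Λ.widen le_self_add) hφ hφ (Ω.sum Λ hnear)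
    (fun k i y => Cochain.extend_congr rfl rfl (fun _ _ _ _ _ => rfl) y)
    (fun k i y => Cochain.extend_congr rfl rfl (fun _ _ _ _ _ => rfl) y)
    ι.injective ι.injective hf hf')

/-- Two refinements induce the same classes, even without widening. -/
theorem IsClassifying.map_eq_map [T2Space B] [ParacompactSpace B] {J : Type*} [Countable J]
    {V : J → Opens B} (hV : IsOpenCover V)
    {cl : ApproxCohomology V d ε → HomotopyClasses B (ThickGrass d (sqrtTwo * ε))}
    (hcl : IsClassifying cl) (μ ν : Refinement V U) (x : ApproxCohomology U d ε) :
    cl (μ.map d ε x) = cl (ν.map d ε x) := by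
  obtain ⟨φ, hφ⟩ := exists_partitionOfUnity hV
  obtain ⟨ι⟩ := nonempty_embedding_nat J
  induction x using Quotient.inductionOn with
  | h Ω =>
    obtain ⟨f, hf, hclf⟩ := hcl.exists_isAverage hφ ι (μ.pullback Ω)
    obtain ⟨f', hf', hclf'⟩ := hcl.exists_isAverage hφ ι (ν.pullback Ω)
    refine hclf.trans ((Quotient.sound ?_).trans hclf'.symm)
    exact homotopic_of_isAverage hφ hφ ((μ.sum ν).pullback Ω)
      (fun k i y => Cochain.extend_congr rfl rfl (fun _ _ _ _ _ => rfl) y)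
      (fun k i y => Cochain.extend_congr rfl rfl (fun _ _ _ _ _ => rfl) y)
      ι.injective ι.injective hf hf'

end Classification

end ApproxBundle

theorem theorem4p13 {B : Type*} [TopologicalSpace B] [T2Space B] [ParacompactSpace B]
    (d : ℕ) [NeZero d] {I : Type*} [Countable I] (U : I → Opens B) (hU : IsOpenCover U)
    (ε : ℝ≥0∞) :
    (∃! cl : ApproxCohomology U d ε → HomotopyClasses B (ThickGrass d (sqrtTwo * ε)),
      IsClassifying cl) ∧
    (∀ cl : ApproxCohomology U d ε → HomotopyClasses B (ThickGrass d (sqrtTwo * ε)),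
      IsClassifying cl →
      ∀ (δ : ℝ≥0∞) (Ω Λ : ApproxCohomology U d ε), distH Ω Λ < δ →
        widen d (sqrtTwo_mul_le_add ε δ) (cl Ω) = widen d (sqrtTwo_mul_le_add ε δ) (cl Λ)) ∧
    (∀ {J : Type*} [Countable J] (V : J → Opens B), IsOpenCover V →
      ∀ clV : ApproxCohomology V d ε → HomotopyClasses B (ThickGrass d (sqrtTwo * ε)),
      IsClassifying clV →
      ∀ (μ ν : Refinement V U) (Ω : ApproxCohomology U d ε),
        widen d (sqrtTwo_mul_le_two ε) (clV (μ.map d ε Ω)) =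
          widen d (sqrtTwo_mul_le_two ε) (clV (ν.map d ε Ω))) :=
  ⟨existsUnique_isClassifying hU d ε, fun _ hcl _ _ _ h => widen_eq_widen_of_distH_lt hU hcl h,
    fun _ hV _ hcl μ ν Ω => congrArg _ (hcl.map_eq_map hV μ ν Ω)⟩
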